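/- **Setting.** Let $K\ge 1$ be the number of arms and $L$ the number of objectives. Let $\mathcal C=\{x\in\mathbb R^L: Ax\ge 0\}$ be a preference cone, where $A$ has linearly independent rows of Euclidean norm $1$. Let $\mathcal M=\{M\in\mathbb R^{L\times K}: M_{\ell k}\in[M_{\min},M_{\max}]\ \forall \ell,k\}$; the column $M_k\in\mathbb R^L$ is the mean reward vector of arm $k$. Let $\Delta_K$ be the probability simplex on $[K]$. *Rewards.* Let $D\subseteq\mathbb R^L$ be open with $[M_{\min},M_{\max}]^L\subseteq D$ (for instance $D=\mathbb R^L$), and let $(P_m)_{m\in D}$ be an exponential family of probability laws on $\mathbb R^L$ parametrised by the mean: $P_m$ has mean $m$ and Lebesgue density $h(x)\exp(\langle\eta(m),T(x)\rangle-\psi(m))$, where $h\ge0$ and $T:\mathbb R^L\to\mathbb R^d$ are measurable and $\eta$ is continuous on $D$ with values in the interior of $\{\theta\in\mathbb R^d:\int h\,e^{\langle\theta,T\rangle}<\infty\}$. For $z\in\mathbb R^L$ let $d_{\rm KL}(z^\top m,z^\top m')$ be the Kullback–Leibler divergence from the law of $z^\top X$, $X\sim P_m$, to the law of $z^\top X$,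 $X\sim P_{m'}$. The bandit has an unknown mean matrix $M\in\mathcal M$; pulling arm $k$ gives, independently of the past, a reward with law $P_{M_k}$. The noise is sub-Gaussian: for some $\sigma\ge 0$, $\mathbb E_{X\sim P_{M_k}}[e^{s\langle u,X-M_k\rangle}]\le e^{\sigma^2\|u\|_2^2s^2/2}$ for all $k$, $u\in\mathbb R^L$ and $s\in\mathbb R$. *Relaxed characteristic time.* Let $\Pi^*(M)$ be the set of Pareto optimal policies: those $\pi\in\Delta_K$ for which no $\pi'\in\Delta_K$ satisfies $M\pi\ne M\pi'$ and $z^\top M(\pi-\pi')\le0$ for all $z\in\mathcal C$. For a policy $\pi^*$ let $$\partial\Lambda_{\pi^*}=\bigcup_{\pi\in\Delta_K\setminus\{\pi^*\}}\{\tilde M\in\mathcal M:\ \exists z\in\mathcal C\setminus\{0\},\ z^\top\tilde M(\pi-\pi^*)=0\},$$ let $\overline{\rm co}$ denote the closed convex hull, and for $a\in[0,\infty)^K$ and a matrix $M'$ with columns in $D$ let $$F(a,M',\pi^*)=\inf_{\tilde M\in\overline{\rm co}(\partial\Lambda_{\pi^*})}\ \inf_{z\in\mathcal C\setminus\{0\}}\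 \sum_{k=1}^K a_k\,d_{\rm KL}(z^\top M'_k,z^\top\tilde M_k),\qquad \overline{\mathcal V}_{\mathcal C}(a,M')=\inf_{\pi^*\in\Pi^*(M')}F(a,M',\pi^*),$$ $$\big(\overline{\mathcal T}_{M,\mathcal C}\big)^{-1}=\sup_{w\in\Delta_K}\overline{\mathcal V}_{\mathcal C}(w,M),\qquad \overline{\mathcal T}_{M,\mathcal C}\in[0,\infty].$$ An infimum over the empty set is $\infty$. *Algorithm PreTS.* After $t$ rounds let $N_{k,t}$ be the number of pulls of arm $k$ and $\hat M_t$ the matrix of empirical means. - Sampling (tracking with forced exploration). For $t\ge 0$ let $w_t\in\arg\max_{w\in\Delta_K}\overline{\mathcal V}_{\mathcal C}(w,\hat M_t)$ be any maximiser; $w_t$ is uniform as long as some arm has not been pulled, and arbitrary in $\Delta_K$ if all arms have been pulled but a column of $\hat M_t$ is outside $D$. Let $\tilde w_t$ be any $\ell_\infty$-projection of $w_t$ on $\{v\in\Delta_K: v_k\ge\varepsilon_t\ \forall k\}$ with $\varepsilon_t=\tfrac12(K^2+t)^{-1/2}$. The next arm is any $k\in\arg\min_{k}\big(N_{k,t}-\sum_{s=0}^{t}\tilde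 w_{s,k}\big)$. All selections and ties may be resolved arbitrarily (also at random), subject to the pulled arm being a random variable determined by the information available before the pull. - Stopping. $\tau\in\mathbb N\cup\{\infty\}$ is the first $t$ such that all arms have been pulled, the columns of $\hat M_t$ are in $D$, and $\sup_{\pi^*\in\Pi^*(\hat M_t)}F(N_t,\hat M_t,\pi^*)\ge\beta(t,\delta)$, where $$\beta(t,\delta)=\sum_{k=1}^K3\ln(1+\ln N_{k,t})+K\,\mathcal T\!\Big(\frac{\ln(1/\delta)}{K}\Big),\qquad \mathcal T(x)=2\tilde h_{3/2}\Big(\frac{h^{-1}(1+x)+\ln(2\zeta(2))}{2}\Big),$$ $h(u)=u-\ln u$ on $[1,\infty)$, and $\tilde h_z(x)=e^{1/h^{-1}(x)}h^{-1}(x)$ if $x\ge h^{-1}(1/\ln z)$, $\tilde h_z(x)=z(x-\ln\ln z)$ otherwise. **Theorem.** For every $M\in\mathcal M$, the stopping time $\tau=\tau_\delta$ of PreTS run with confidence parameter $\delta\in(0,1)$ satisfies $$\limsup_{\delta\to0^+}\frac{\mathbb E[\tau_\delta]}{\log(1/\delta)}\le\overline{\mathcal T}_{M,\mathcal C}.$$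 -/

import Mathlib

open MeasureTheory ProbabilityTheory InformationTheory Filter Topology Set
open scoped ENNReal NNReal RealInnerProductSpace BigOperators

noncomputable section

namespace PreTS

/-- Reward vectors: `ℝ^L` with the Euclidean inner product. -/
abbrev Vec (L : ℕ) : Type := EuclideanSpace ℝ (Fin L)

/-- A matrix `M ∈ ℝ^{L × K}`, given by its `K` columns `M k ∈ ℝ^L`. -/
abbrev Inst (L K : ℕ) : Type := Fin K → Vec L

/-- `M π = ∑ k, π k • M k`. -/
def Inst.mulVec {L K : ℕ} (M : Inst L K) (p : Fin K → ℝ) : Vec L := ∑ k, p k • M k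

/-- The set `𝓜` of matrices all of whose entries lie in `[Mmin, Mmax]`. -/
def instSet (L K : ℕ) (Mmin Mmax : ℝ) : Set (Inst L K) :=
  {M | ∀ k l, M k l ∈ Icc Mmin Mmax}

/-- A preference cone: `{x | A x ≥ 0}` with `A` of full row rank and with unit rows. -/
def IsPreferenceCone {L : ℕ} (C : Set (Vec L)) : Prop :=
  ∃ (n : ℕ) (A : Fin n → Vec L), LinearIndependent ℝ A ∧ (∀ i, ‖A i‖ = 1) ∧
    C = {x | ∀ i, 0 ≤ ⟪A i, x⟫}

/-- The order on reward vectors: `μ ⪯ μ'` iff `zᵀ(μ - μ') ≤ 0` for all preferences `z ∈ C`. -/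
def ConeLE {L : ℕ} (C : Set (Vec L)) (μ μ' : Vec L) : Prop := ∀ z ∈ C, ⟪z, μ - μ'⟫ ≤ 0

/-- The set `Π*(M)` of Pareto optimal policies: the policies in the simplex whose mean reward
vector is not dominated by that of another policy. -/
def paretoPolicies {L K : ℕ} (C : Set (Vec L)) (M : Inst L K) : Set (Fin K → ℝ) :=
  {p | p ∈ stdSimplex ℝ (Fin K) ∧
    ¬ ∃ q ∈ stdSimplex ℝ (Fin K), ConeLE C (M.mulVec p) (M.mulVec q) ∧ M.mulVec p ≠ M.mulVec q}

/-- The boundary `∂Λ` of the alternating set with respect to the policy `pstar`. -/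
def altBoundary {L K : ℕ} (C : Set (Vec L)) (Mmin Mmax : ℝ) (pstar : Fin K → ℝ) :
    Set (Inst L K) :=
  {N | N ∈ instSet L K Mmin Mmax ∧ ∃ p ∈ stdSimplex ℝ (Fin K), p ≠ pstar ∧
    ∃ z ∈ C, z ≠ 0 ∧ ⟪z, N.mulVec (p - pstar)⟫ = 0}

/-- `P m`, for `m` in the open set `D ⊆ ℝ^L`, is an exponential family of laws on `ℝ^L` that is
parametrised by its mean: `P m` has mean `m` and the density
`h x * exp (⟪η m, T x⟫ - ψ m)` with respect to the Lebesgue measure, where `η` is continuous and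
takes its values in the interior of the natural parameter space. -/
def IsMeanExpFamily {L : ℕ} (D : Set (Vec L)) (P : Vec L → Measure (Vec L)) : Prop :=
  IsOpen D ∧
  ∃ (d : ℕ) (h : Vec L → ℝ) (T : Vec L → Vec d) (η : Vec L → Vec d) (ψ : Vec L → ℝ),
    Measurable h ∧ (∀ x, 0 ≤ h x) ∧ Measurable T ∧ ContinuousOn η D ∧
    ∀ m ∈ D,
      P m = volume.withDensity (fun x => ENNReal.ofReal (h x * Real.exp (⟪η m, T x⟫ - ψ m))) ∧
      η m ∈ interior {θ | Integrable (fun x => h x * Real.exp ⟪θ, T x⟫) volume} ∧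
      IsProbabilityMeasure (P m) ∧
      Integrable (fun x => x) (P m) ∧ ∫ x, x ∂(P m) = m

/-- The centred law `ν` with mean `m` is sub-Gaussian with parameter `σ`. -/
def IsSubGaussianVec {L : ℕ} (ν : Measure (Vec L)) (m : Vec L) (σ : ℝ≥0) : Prop :=
  ∀ u : Vec L, HasSubgaussianMGF (fun x => ⟪u, x - m⟫) (σ ^ 2 * ‖u‖₊ ^ 2) ν

/-- `d_KL(zᵀ m, zᵀ m')`: the Kullback-Leibler divergence between the laws of `zᵀ X` for
`X ~ P m` and for `X ~ P m'`. -/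
def projKL {L : ℕ} (P : Vec L → Measure (Vec L)) (z m m' : Vec L) : ℝ≥0∞ :=
  klDiv ((P m).map (fun x => ⟪z, x⟫)) ((P m').map (fun x => ⟪z, x⟫))

/-- `min` over the closed convex hull of `∂Λ` and over the non-zero preferences `z` of
`∑ k, a k * d_KL(zᵀ M k, zᵀ N k)`. -/
def relaxedInf {L K : ℕ} (C : Set (Vec L)) (Mmin Mmax : ℝ) (P : Vec L → Measure (Vec L))
    (a : Fin K → ℝ≥0∞) (M : Inst L K) (pstar : Fin K → ℝ) : ℝ≥0∞ :=
  ⨅ N ∈ closedConvexHull ℝ (altBoundary C Mmin Mmax pstar), ⨅ z ∈ C \ {0},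
    ∑ k, a k * projKL P z (M k) (N k)

/-- The objective of the convexified lower bound, for the allocation `w`. -/
def relaxedValue {L K : ℕ} (C : Set (Vec L)) (Mmin Mmax : ℝ) (P : Vec L → Measure (Vec L))
    (w : Fin K → ℝ) (M : Inst L K) : ℝ≥0∞ :=
  ⨅ pstar ∈ paretoPolicies C M,
    relaxedInf C Mmin Mmax P (fun k => ENNReal.ofReal (w k)) M pstar

/-- The characteristic time of the convexified lower bound, an element of `[0, ∞]`. -/
def relaxedTime {L K : ℕ} (C : Set (Vec L)) (Mmin Mmax : ℝ) (P : Vec L → Measure (Vec L))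
    (M : Inst L K) : ℝ≥0∞ :=
  (⨆ w ∈ stdSimplex ℝ (Fin K), relaxedValue C Mmin Mmax P w M)⁻¹

/-- `h u = u - ln u`. -/
def hFun (u : ℝ) : ℝ := u - Real.log u

/-- The inverse of the bijection `h` of `[1, ∞)`. -/
def hInv : ℝ → ℝ := Function.invFunOn hFun (Ici 1)

/-- The function `h̃_z`. -/
def hTilde (z x : ℝ) : ℝ :=
  if hInv (1 / Real.log z) ≤ x then Real.exp (1 / hInv x) * hInv x
  else z * (x - Real.log (Real.log z))

/-- The function `𝒯` of the threshold. -/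
def calT (x : ℝ) : ℝ :=
  2 * hTilde (3 / 2) ((hInv (1 + x) + Real.log (2 * ∑' n : ℕ, 1 / ((n : ℝ) + 1) ^ 2)) / 2)

/-- The threshold `β(t, δ)`, as a function of the numbers of pulls `N k`. -/
def threshold {K : ℕ} (N : Fin K → ℕ) (δ : ℝ) : ℝ :=
  ∑ k, 3 * Real.log (1 + Real.log (N k)) + K * calT (Real.log (1 / δ) / K)

section Run

variable {L K : ℕ} {Ω : Type*}

/-- The number of pulls of arm `k` among the first `t` rounds (rounds are numbered from `0`). -/
def pulls (arm : ℕ → Ω → Fin K) (t : ℕ) (ω : Ω) (k : Fin K) : ℕ :=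
  ((Finset.range t).filter (fun s => arm s ω = k)).card

/-- The matrix of empirical means after `t` rounds. -/
def empMean (arm : ℕ → Ω → Fin K) (R : ℕ → Ω → Vec L) (t : ℕ) (ω : Ω) : Inst L K := fun k =>
  (pulls arm t ω k : ℝ)⁻¹ • ∑ s ∈ (Finset.range t).filter (fun s => arm s ω = k), R s ω

/-- After `t` rounds each arm has been pulled and the empirical means are possible means, that
is, they belong to the domain `D` of the reward family (no condition if `D` is everything). -/
def Estimable (D : Set (Vec L)) (arm : ℕ → Ω → Fin K) (R : ℕ → Ω → Vec L) (t : ℕ) (ω : Ω) :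
    Prop :=
  ∀ k, 0 < pulls arm t ω k ∧ empMean arm R t ω k ∈ D

/-- The amount of forced exploration `ε_t = 1 / (2 √(K² + t))`. -/
def explore (K t : ℕ) : ℝ := 1 / (2 * Real.sqrt ((K : ℝ) ^ 2 + t))

/-- The allocations that give each arm at least the weight `ε`. -/
def truncSimplex (K : ℕ) (ε : ℝ) : Set (Fin K → ℝ) :=
  {v | v ∈ stdSimplex ℝ (Fin K) ∧ ∀ k, ε ≤ v k}

/-- `(arm, R)` is an interaction, without stopping, of the sampling rule of the algorithm with
the bandit that has the arm laws `P (M k)`. In round `t` the arm `arm t` is pulled and the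
reward `R t` observed; `ℱ t` is the information available before that pull, `w t` the
allocation computed from it and `v t` the projection of `w t` used for tracking. -/
structure IsRun [mΩ : MeasurableSpace Ω] (C : Set (Vec L)) (Mmin Mmax : ℝ) (D : Set (Vec L))
    (P : Vec L → Measure (Vec L)) (M : Inst L K) (Pr : Measure Ω) (ℱ : Filtration ℕ mΩ)
    (arm : ℕ → Ω → Fin K) (R : ℕ → Ω → Vec L) (w v : ℕ → Ω → Fin K → ℝ) : Prop where
  arm_meas : ∀ t, Measurable[ℱ t] (arm t)
  reward_meas : ∀ t, Measurable[ℱ (t + 1)] (R t)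
  /-- Given the past, the reward has the law of the arm that is pulled. -/
  reward_law : ∀ t (B : Set (Vec L)), MeasurableSet B →
    Pr[(R t ⁻¹' B).indicator (fun _ => (1 : ℝ)) | ℱ t]
      =ᵐ[Pr] fun ω => (P (M (arm t ω))).real B
  alloc_mem : ∀ t ω, w t ω ∈ stdSimplex ℝ (Fin K)
  /-- The allocation is uniform until each arm has been pulled. -/
  alloc_init : ∀ t ω, (∃ k, pulls arm t ω k = 0) → w t ω = fun _ => (K : ℝ)⁻¹
  /-- Then it is an optimal allocation, any one, for the empirical means. -/
  alloc_opt : ∀ t ω, Estimable D arm R t ω →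
    IsMaxOn (fun u => relaxedValue C Mmin Mmax P u (empMean arm R t ω))
      (stdSimplex ℝ (Fin K)) (w t ω)
  /-- `v t` is a sup-norm projection of `w t` to the allocations with forced exploration. -/
  proj_mem : ∀ t ω, v t ω ∈ truncSimplex K (explore K t)
  proj_min : ∀ t ω, IsMinOn (fun u => ‖u - w t ω‖) (truncSimplex K (explore K t)) (v t ω)
  /-- Tracking of the cumulated allocations, with ties broken in any way. -/
  track : ∀ t ω, IsMinOn
    (fun k => (pulls arm t ω k : ℝ) - ∑ s ∈ Finset.range (t + 1), v s ω k) univ (arm t ω)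

/-- The statistic of the stopping rule after `t` rounds. -/
def stopStat (C : Set (Vec L)) (Mmin Mmax : ℝ) (P : Vec L → Measure (Vec L))
    (arm : ℕ → Ω → Fin K) (R : ℕ → Ω → Vec L) (t : ℕ) (ω : Ω) : ℝ≥0∞ :=
  ⨆ pstar ∈ paretoPolicies C (empMean arm R t ω),
    relaxedInf C Mmin Mmax P (fun k => (pulls arm t ω k : ℝ≥0∞)) (empMean arm R t ω) pstar

/-- The stopping time `τ`: the first number of rounds after which the statistic reaches the
threshold, and `∞` if this never happens. -/
def stopTime (C : Set (Vec L)) (Mmin Mmax : ℝ) (D : Set (Vec L))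
    (P : Vec L → Measure (Vec L)) (arm : ℕ → Ω → Fin K) (R : ℕ → Ω → Vec L) (δ : ℝ) (ω : Ω) :
    ℝ≥0∞ :=
  ⨅ t ∈ {t : ℕ | Estimable D arm R t ω ∧
    ENNReal.ofReal (threshold (pulls arm t ω) δ) ≤ stopStat C Mmin Mmax P arm R t ω}, (t : ℝ≥0∞)

end Run

end PreTS

end

namespace PreTS

/-! ### Perturbation of the Kullback-Leibler divergence -/

/-! Choose `V < V₂` below the supremum of `relaxedValue` at `M`. It suffices to bound the mean
stopping time by `log (1 / δ) / V` plus a constant independent of `δ`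
(`exists_lintegral_stopTime_le`); if the supremum is `0`, the claimed bound is `∞`.

A positive relaxed value is a rigid condition, since `M` then lies on the boundary of none of its
Pareto policies. Either one arm is strictly best for all nonzero preferences, which persists near
`M`, or the cone is the whole space and the boundary does not depend on the policy. So all instances
near `M`, with all their Pareto policies, share one set `A` of alternatives
(`exists_locally_constant_alternatives`). Near `M` the infimum over policies in `relaxedValue` and
the supremum in `stopStat` are then both vacuous, and continuity in the instance reduces to
continuity of the divergence in its first argument. The latter is uniform in the preference and in
the second argument over the box: it follows by a change of measure (`klDiv_le_klDiv_add`) from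
moments of likelihood ratios, which projection does not increase
(`IsMeanExpFamily.exists_nhds_projKL`).

For a fixed alternative and preference the evidence is linear in the pulls. While the empirical
means stay near `M`, each allocation is almost optimal for every nearby instance, in particular for
the empirical means at the final time `T`. Summing over rounds and using tracking, the evidence at
`T` is at least about `V * T` (`IsRun.le_stopStat`); the allocations need not converge. The
threshold is `(1 + o(1)) * log (1 / δ) + O(log T)`, so stopping occurs by `T ≈ log (1 / δ) / V`
(`exists_stopTime_le`).

Forced exploration gives each arm order `√t` pulls, so exponential supermartingales make the sum of
`t + 1` over the rounds `t` with a deviation integrable (`exists_lintegral_deviates_le`). This sum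
dominates the last deviation time, which therefore costs only an additive constant. -/

lemma mul_sq_log_le {a x : ℝ} (ha : 0 < a) (hx : 0 ≤ x) :
    x * Real.log x ^ 2 ≤ 4 / a ^ 2 * x ^ (1 + a) + 4 := by
  rcases hx.eq_or_lt with rfl | hx
  · simp only [Real.log_zero, zero_mul]; positivity
  have h1 : 0 ≤ 4 / a ^ 2 * x ^ (1 + a) := by positivity
  rcases le_total 1 x with h | h
  · have hl := Real.log_le_rpow_div hx.le (half_pos ha)
    have hl0 := Real.log_nonneg h
    have : Real.log x ^ 2 ≤ (x ^ (a / 2) / (a / 2)) ^ 2 := by gcongr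
    have e : (x ^ (a / 2)) ^ 2 = x ^ a := by
      rw [← Real.rpow_natCast, ← Real.rpow_mul hx.le]; norm_num
    rw [div_pow, e] at this
    rw [Real.rpow_add hx, Real.rpow_one]
    have := mul_le_mul_of_nonneg_left this hx.le
    calc _ ≤ _ := this
      _ = 4 / a ^ 2 * (x * x ^ a) := by ring
      _ ≤ _ := by linarith
  -- For `x ≤ 1` the bound `log (1 / x) ≤ 2 / √x` gives the constant `4`.
  · have hl := Real.log_le_rpow_div (x := x⁻¹) (by positivity) (half_pos one_pos)
    rw [Real.log_inv] at hl
    have hl0 : 0 ≤ -Real.log x := by linarith [Real.log_nonpos hx.le h]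
    have : (-Real.log x) ^ 2 ≤ ((x⁻¹) ^ ((1 : ℝ) / 2) / (1 / 2)) ^ 2 := by gcongr
    have e : ((x⁻¹) ^ ((1 : ℝ) / 2)) ^ 2 = x⁻¹ := by
      rw [← Real.rpow_natCast, ← Real.rpow_mul (by positivity)]; norm_num
    rw [div_pow, e, neg_sq] at this
    have := mul_le_mul_of_nonneg_left this hx.le
    have e2 : x * (x⁻¹ / (1 / 2) ^ 2) = 4 := by field_simp; norm_num
    linarith

set_option linter.unusedSectionVars false

section Perturbation

variable {Y : Type*} [MeasurableSpace Y] {μ μ' ν : Measure Y} [IsProbabilityMeasure μ]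
  [IsProbabilityMeasure μ'] [IsProbabilityMeasure ν]

lemma rnDeriv_toReal_pos (h : μ ≪ ν) : ∀ᵐ y ∂μ, 0 < (μ.rnDeriv ν y).toReal := by
  filter_upwards [Measure.rnDeriv_pos h, h (Measure.rnDeriv_lt_top μ ν)] with y h0 h1
  exact ENNReal.toReal_pos h0.ne' h1.ne

/-- Applying `mul_sq_log_le` to the density trades the second moment of the log-likelihood ratio
under `μ` for a moment of order slightly above one of the density under `ν`. -/
lemma integrable_sq_llr (h : μ ≪ ν) {a : ℝ} (ha : 0 < a)
    (hi : Integrable (fun y => (μ.rnDeriv ν y).toReal ^ (1 + a)) ν) :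
    Integrable (fun y => llr μ ν y ^ 2) μ ∧
      ∫ y, llr μ ν y ^ 2 ∂μ
        ≤ 4 / a ^ 2 * ∫ y, (μ.rnDeriv ν y).toReal ^ (1 + a) ∂ν + 4 := by
  have hb : Integrable (fun y => 4 / a ^ 2 * (μ.rnDeriv ν y).toReal ^ (1 + a) + 4) ν :=
    (hi.const_mul _).add (integrable_const _)
  have hle : ∀ y, (μ.rnDeriv ν y).toReal * llr μ ν y ^ 2
      ≤ 4 / a ^ 2 * (μ.rnDeriv ν y).toReal ^ (1 + a) + 4 := fun y =>
    mul_sq_log_le ha ENNReal.toReal_nonneg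
  have hint : Integrable (fun y => (μ.rnDeriv ν y).toReal * llr μ ν y ^ 2) ν := by
    refine hb.mono' ?_ (ae_of_all _ fun y => ?_)
    · exact (((Measure.measurable_rnDeriv μ ν).ennreal_toReal).mul
        ((measurable_llr μ ν).pow_const 2)).aestronglyMeasurable
    · rw [Real.norm_of_nonneg (by positivity)]
      exact hle y
  refine ⟨(integrable_toReal_rnDeriv_mul_iff h).1 hint, ?_⟩
  rw [← integral_toReal_rnDeriv_mul h]
  refine (integral_mono hint hb hle).trans_eq ?_
  rw [integral_add (hi.const_mul _) (integrable_const _), integral_const_mul]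
  simp

lemma integral_llr_nonneg (h : μ ≪ ν) (hi : Integrable (llr μ ν) μ) : 0 ≤ ∫ y, llr μ ν y ∂μ := by
  simpa using integral_llr_add_sub_measure_univ_nonneg h hi

lemma klDiv_eq_ofReal_integral_llr (h : μ ≪ ν) (hi : Integrable (llr μ ν) μ) :
    klDiv μ ν = ENNReal.ofReal (∫ y, llr μ ν y ∂μ) := by
  rw [klDiv_of_ac_of_integrable h hi]; simp

lemma integrable_llr_of_sq (hi : Integrable (fun y => llr μ ν y ^ 2) μ) :
    Integrable (llr μ ν) μ :=
  ((memLp_two_iff_integrable_sq (measurable_llr μ ν).aestronglyMeasurable).2 hi).integrable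
    (by norm_num)

lemma integral_mul_le_sqrt {f g : Y → ℝ} (hf : MemLp f 2 μ) (hg : MemLp g 2 μ) :
    ∫ y, f y * g y ∂μ ≤ √(∫ y, f y ^ 2 ∂μ) * √(∫ y, g y ^ 2 ∂μ) := by
  have h2 : ENNReal.ofReal 2 = 2 := by norm_num
  have := integral_mul_norm_le_Lp_mul_Lq (f := f) (g := g) (μ := μ)
    (Real.holderConjugate_iff.2 ⟨one_lt_two, by norm_num⟩ : (2 : ℝ).HolderConjugate 2)
    (by rwa [h2]) (by rwa [h2])
  have hle : ∫ y, f y * g y ∂μ ≤ ∫ y, ‖f y‖ * ‖g y‖ ∂μ := by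
    refine integral_mono (hf.integrable_mul hg) ?_ fun y => ?_
    · exact hf.norm.integrable_mul hg.norm
    · simpa [abs_mul] using le_abs_self (f y * g y)
  refine hle.trans (this.trans_eq ?_)
  simp [Real.sqrt_eq_rpow]

lemma klDiv_le_of_integrable_rpow (h : μ ≪ ν) {a S : ℝ} (ha : 0 < a)
    (hi : Integrable (fun y => (μ.rnDeriv ν y).toReal ^ (1 + a)) ν)
    (hS : ∫ y, (μ.rnDeriv ν y).toReal ^ (1 + a) ∂ν ≤ S) :
    klDiv μ ν ≤ ENNReal.ofReal (√(4 / a ^ 2 * S + 4)) := by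
  obtain ⟨h2, h2'⟩ := integrable_sq_llr h ha hi
  rw [klDiv_eq_ofReal_integral_llr h (integrable_llr_of_sq h2)]
  refine ENNReal.ofReal_le_ofReal ?_
  have hm : MemLp (llr μ ν) 2 μ :=
    (memLp_two_iff_integrable_sq (measurable_llr μ ν).aestronglyMeasurable).2 h2
  have := integral_mul_le_sqrt hm (memLp_const (1 : ℝ))
  simp only [mul_one, one_pow, integral_const, probReal_univ, smul_eq_mul, Real.sqrt_one] at this
  refine this.trans (Real.sqrt_le_sqrt (h2'.trans ?_))
  gcongr

/-- With `g = dμ'/dμ`, the chain rule and Gibbs' inequality give `klDiv μ' ν ≥ ∫ g * llr μ ν ∂μ`.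
What remains is `∫ (1 - g) * llr μ ν ∂μ`, which Cauchy-Schwarz bounds by the chi-square distance and
the second moment of the log-likelihood ratio. -/
lemma klDiv_le_klDiv_add (h : μ ≪ ν) (h' : μ' ≪ μ) {a S χ : ℝ} (ha : 0 < a)
    (hi : Integrable (fun y => (μ.rnDeriv ν y).toReal ^ (1 + a)) ν)
    (hS : ∫ y, (μ.rnDeriv ν y).toReal ^ (1 + a) ∂ν ≤ S)
    (hχ : Integrable (fun y => (μ'.rnDeriv μ y).toReal ^ 2) μ)
    (hχ' : ∫ y, (μ'.rnDeriv μ y).toReal ^ 2 ∂μ ≤ 1 + χ) :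
    klDiv μ ν ≤ klDiv μ' ν + ENNReal.ofReal (√χ * √(4 / a ^ 2 * S + 4)) := by
  obtain ⟨h2, h2'⟩ := integrable_sq_llr h ha hi
  by_cases hint : Integrable (llr μ' ν) μ'
  swap
  · rw [klDiv_of_not_integrable hint]; simp
  have hm : MemLp (llr μ ν) 2 μ :=
    (memLp_two_iff_integrable_sq (measurable_llr μ ν).aestronglyMeasurable).2 h2
  set g : Y → ℝ := fun y => (μ'.rnDeriv μ y).toReal with hg
  have hgm : MemLp g 2 μ := (memLp_two_iff_integrable_sq
    (Measure.measurable_rnDeriv _ _).ennreal_toReal.aestronglyMeasurable).2 hχ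
  have hg1 : ∫ y, g y ∂μ = 1 := by
    rw [hg, Measure.integral_toReal_rnDeriv h']; simp
  have hφi := integrable_llr_of_sq h2
  have hgφ : Integrable (fun y => g y * llr μ ν y) μ := hgm.integrable_mul hm
  have hφ' : Integrable (llr μ ν) μ' := (integrable_toReal_rnDeriv_mul_iff h').1 hgφ
  -- chain rule and Gibbs' inequality
  have hchain : ∀ᵐ y ∂μ', llr μ' ν y = llr μ' μ y + llr μ ν y := by
    have h1 := (h'.trans h) (Measure.rnDeriv_mul_rnDeriv (κ := ν) h')
    filter_upwards [h1, rnDeriv_toReal_pos h', h' (rnDeriv_toReal_pos h)]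
      with y hy hp hq
    simp only [llr, ← hy, Pi.mul_apply, ENNReal.toReal_mul]
    rw [Real.log_mul hp.ne' hq.ne']
  have hll : Integrable (llr μ' μ) μ' := by
    refine (hint.sub hφ').congr ?_
    filter_upwards [hchain] with y hy
    simp [hy]
  have hgibbs : ∫ y, g y * llr μ ν y ∂μ ≤ ∫ y, llr μ' ν y ∂μ' := by
    rw [integral_toReal_rnDeriv_mul h', integral_congr_ae hchain, integral_add hll hφ']
    linarith [integral_llr_nonneg h' hll]
  have hvar : ∫ y, (1 - g y) ^ 2 ∂μ ≤ χ := by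
    have : ∫ y, (1 - g y) ^ 2 ∂μ = ∫ y, (1 - 2 * g y + g y ^ 2) ∂μ := by
      congr 1; ext y; ring
    have hgi : Integrable g μ := hgm.integrable (by norm_num)
    have e1 : ∫ y, (1 - 2 * g y + g y ^ 2) ∂μ
        = ∫ y, (1 - 2 * g y) ∂μ + ∫ y, g y ^ 2 ∂μ :=
      integral_add ((integrable_const _).sub (hgi.const_mul 2)) hχ
    rw [this, e1, integral_sub (integrable_const _) (hgi.const_mul 2),
      integral_const_mul, hg1]
    simp only [integral_const, probReal_univ, smul_eq_mul]
    linarith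
  have hcs := integral_mul_le_sqrt ((memLp_const (1 : ℝ)).sub hgm) hm
  have hsplit : ∫ y, (1 - g y) * llr μ ν y ∂μ
      = ∫ y, llr μ ν y ∂μ - ∫ y, g y * llr μ ν y ∂μ := by
    rw [← integral_sub hφi hgφ]; congr 1; ext y; ring
  have hfin : ∫ y, llr μ ν y ∂μ ≤ ∫ y, llr μ' ν y ∂μ' + √χ * √(4 / a ^ 2 * S + 4) := by
    have : ∫ y, (1 - g y) * llr μ ν y ∂μ ≤ √χ * √(4 / a ^ 2 * S + 4) := by
      refine hcs.trans ?_
      gcongr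
      · exact hvar
      · refine h2'.trans ?_
        gcongr
    linarith
  rw [klDiv_eq_ofReal_integral_llr h hφi, klDiv_eq_ofReal_integral_llr (h'.trans h) hint,
    ← ENNReal.ofReal_add (integral_llr_nonneg (h'.trans h) hint) (by positivity)]
  exact ENNReal.ofReal_le_ofReal hfin

end Perturbation

/-! ### Likelihood-ratio moments under pushforward -/

section Map

variable {X Y : Type*} [MeasurableSpace X] [MeasurableSpace Y] {P P' Q : Measure X}
  [IsProbabilityMeasure P] [IsProbabilityMeasure P'] [IsProbabilityMeasure Q] {f : X → Y}

/-- The density of the image laws, pulled back along `f`, is a conditional expectation of the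
original density, so conditional Jensen applies. Moment bounds for the vector laws thus pass to all
projections `zᵀX` with constants free of `z`. -/
lemma integral_comp_rnDeriv_map_le (h : P ≪ Q) (hf : Measurable f) {F : ℝ → ℝ}
    (hF : Continuous F) (hFc : ConvexOn ℝ (Ici 0) F)
    (hi : Integrable (fun x => F (P.rnDeriv Q x).toReal) Q) :
    Integrable (fun y => F ((P.map f).rnDeriv (Q.map f) y).toReal) (Q.map f) ∧
      ∫ y, F ((P.map f).rnDeriv (Q.map f) y).toReal ∂(Q.map f)
        ≤ ∫ x, F (P.rnDeriv Q x).toReal ∂Q := by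
  have hint := hFc.integrable_comp_rnDeriv_map h hf hF.stronglyMeasurable
    hF.continuousWithinAt hi
  refine ⟨hint, ?_⟩
  rw [integral_map hf.aemeasurable hint.aestronglyMeasurable]
  refine le_trans ?_ (integral_condExp hf.comap_le).le
  exact integral_mono_ae (hint.comp_measurable hf) integrable_condExp
    (hFc.comp_rnDeriv_map_le h hf hF.stronglyMeasurable hF.continuousWithinAt hi)

lemma klDiv_map_le_of_integrable_rpow (h : P ≪ Q) (hf : Measurable f) {a S : ℝ} (ha : 0 < a)
    (hi : Integrable (fun x => (P.rnDeriv Q x).toReal ^ (1 + a)) Q)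
    (hS : ∫ x, (P.rnDeriv Q x).toReal ^ (1 + a) ∂Q ≤ S) :
    klDiv (P.map f) (Q.map f) ≤ ENNReal.ofReal (√(4 / a ^ 2 * S + 4)) := by
  have := Measure.isProbabilityMeasure_map (μ := P) hf.aemeasurable
  have := Measure.isProbabilityMeasure_map (μ := Q) hf.aemeasurable
  obtain ⟨h1, h2⟩ := integral_comp_rnDeriv_map_le h hf
    (Real.continuous_rpow_const (by linarith)) (convexOn_rpow (by linarith : 1 ≤ 1 + a)) hi
  exact klDiv_le_of_integrable_rpow (h.map hf) ha h1 (h2.trans hS)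

lemma klDiv_map_le_klDiv_map_add (h : P ≪ Q) (h' : P' ≪ P) (hf : Measurable f) {a S χ : ℝ}
    (ha : 0 < a)
    (hi : Integrable (fun x => (P.rnDeriv Q x).toReal ^ (1 + a)) Q)
    (hS : ∫ x, (P.rnDeriv Q x).toReal ^ (1 + a) ∂Q ≤ S)
    (hχ : Integrable (fun x => (P'.rnDeriv P x).toReal ^ 2) P)
    (hχ' : ∫ x, (P'.rnDeriv P x).toReal ^ 2 ∂P ≤ 1 + χ) :
    klDiv (P.map f) (Q.map f)
      ≤ klDiv (P'.map f) (Q.map f) + ENNReal.ofReal (√χ * √(4 / a ^ 2 * S + 4)) := by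
  have := Measure.isProbabilityMeasure_map (μ := P) hf.aemeasurable
  have := Measure.isProbabilityMeasure_map (μ := P') hf.aemeasurable
  have := Measure.isProbabilityMeasure_map (μ := Q) hf.aemeasurable
  obtain ⟨h1, h2⟩ := integral_comp_rnDeriv_map_le h hf
    (Real.continuous_rpow_const (by linarith)) (convexOn_rpow (by linarith : 1 ≤ 1 + a)) hi
  obtain ⟨h3, h4⟩ := integral_comp_rnDeriv_map_le h' hf
    (continuous_pow 2) (convexOn_pow 2) hχ
  exact klDiv_le_klDiv_add (h.map hf) (h'.map hf) ha h1 (h2.trans hS) h3 (h4.trans hχ')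

end Map


/-! ### Exponential families parametrised by the mean -/

section Laplace

variable {X : Type*} [MeasurableSpace X] {d : ℕ}

/-- The set of natural parameters of the family with carrier `h • ρ` and statistic `T`. -/
def naturalSet (ρ : Measure X) (h : X → ℝ) (T : X → Vec d) : Set (Vec d) :=
  {θ | Integrable (fun x => h x * Real.exp ⟪θ, T x⟫) ρ}

/-- The Laplace transform of `h • ρ` along the statistic `T`. -/
noncomputable def laplace (ρ : Measure X) (h : X → ℝ) (T : X → Vec d) (θ : Vec d) : ℝ :=
  ∫ x, h x * Real.exp ⟪θ, T x⟫ ∂ρ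

variable {ρ : Measure X} {h : X → ℝ} {T : X → Vec d}

omit [MeasurableSpace X] in
lemma mul_exp_inner_convex (h0 : ∀ x, 0 ≤ h x) (θ θ' : Vec d) {a b : ℝ} (ha : 0 ≤ a) (hb : 0 ≤ b)
    (hab : a + b = 1) (x : X) :
    h x * Real.exp ⟪a • θ + b • θ', T x⟫
      ≤ a * (h x * Real.exp ⟪θ, T x⟫) + b * (h x * Real.exp ⟪θ', T x⟫) := by
  have := convexOn_exp.2 (mem_univ ⟪θ, T x⟫) (mem_univ ⟪θ', T x⟫) ha hb hab
  simp only [smul_eq_mul] at this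
  rw [inner_add_left, real_inner_smul_left, real_inner_smul_left]
  nlinarith [mul_le_mul_of_nonneg_left this (h0 x)]

lemma convexOn_laplace (hm : Measurable h) (h0 : ∀ x, 0 ≤ h x) (hT : Measurable T) :
    ConvexOn ℝ (naturalSet ρ h T) (laplace ρ h T) := by
  have hint : ∀ θ ∈ naturalSet ρ h T, ∀ θ' ∈ naturalSet ρ h T, ∀ a b : ℝ, 0 ≤ a → 0 ≤ b →
      Integrable (fun x => a * (h x * Real.exp ⟪θ, T x⟫) + b * (h x * Real.exp ⟪θ', T x⟫)) ρ :=
    fun θ hθ θ' hθ' a b _ _ => (hθ.const_mul a).add (hθ'.const_mul b)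
  have hmem : ∀ θ ∈ naturalSet ρ h T, ∀ θ' ∈ naturalSet ρ h T, ∀ a b : ℝ, 0 ≤ a → 0 ≤ b →
      a + b = 1 → a • θ + b • θ' ∈ naturalSet ρ h T := by
    intro θ hθ θ' hθ' a b ha hb hab
    refine (hint θ hθ θ' hθ' a b ha hb).mono' ?_ (ae_of_all _ fun x => ?_)
    · exact (hm.mul (by fun_prop)).aestronglyMeasurable
    · rw [Real.norm_of_nonneg (mul_nonneg (h0 x) (Real.exp_pos _).le)]
      exact mul_exp_inner_convex h0 θ θ' ha hb hab x
  refine ⟨fun θ hθ θ' hθ' a b ha hb hab => hmem θ hθ θ' hθ' a b ha hb hab,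
    fun θ hθ θ' hθ' a b ha hb hab => ?_⟩
  simp only [laplace, smul_eq_mul]
  rw [← integral_const_mul, ← integral_const_mul, ← integral_add (hθ.const_mul a) (hθ'.const_mul b)]
  exact integral_mono (hmem θ hθ θ' hθ' a b ha hb hab) (hint θ hθ θ' hθ' a b ha hb)
    (mul_exp_inner_convex h0 θ θ' ha hb hab)

lemma continuousAt_laplace (hm : Measurable h) (h0 : ∀ x, 0 ≤ h x) (hT : Measurable T)
    {θ : Vec d} (hθ : θ ∈ interior (naturalSet ρ h T)) : ContinuousAt (laplace ρ h T) θ :=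
  (convexOn_laplace hm h0 hT).continuousOn_interior.continuousAt
    (isOpen_interior.mem_nhds hθ)

/-- The density of one law of the family with respect to another. -/
lemma withDensity_expFamily_eq (hm : Measurable h) (h0 : ∀ x, 0 ≤ h x) (hT : Measurable T)
    (θ θ' : Vec d) (c c' : ℝ) :
    ρ.withDensity (fun x => ENNReal.ofReal (h x * Real.exp (⟪θ', T x⟫ - c')))
      = (ρ.withDensity (fun x => ENNReal.ofReal (h x * Real.exp (⟪θ, T x⟫ - c)))).withDensity
        (fun x => ENNReal.ofReal (Real.exp (⟪θ' - θ, T x⟫ - (c' - c)))) := by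
  rw [← withDensity_mul _ (by fun_prop) (by fun_prop)]
  congr 1
  ext x
  rw [Pi.mul_apply, ← ENNReal.ofReal_mul (mul_nonneg (h0 x) (Real.exp_pos _).le), mul_assoc,
    ← Real.exp_add, inner_sub_left]
  congr 3
  ring

lemma exp_eq_laplace {θ : Vec d} {c : ℝ} (h0 : ∀ x, 0 ≤ h x)
    (hθ : θ ∈ naturalSet ρ h T)
    [IsProbabilityMeasure
      (ρ.withDensity (fun x => ENNReal.ofReal (h x * Real.exp (⟪θ, T x⟫ - c))))] :
    laplace ρ h T θ = Real.exp c := by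
  have h1 : ∀ x, h x * Real.exp (⟪θ, T x⟫ - c) = Real.exp (-c) * (h x * Real.exp ⟪θ, T x⟫) := by
    intro x; rw [sub_eq_add_neg, Real.exp_add]; ring
  have hu := measure_univ
    (μ := ρ.withDensity (fun x => ENNReal.ofReal (h x * Real.exp (⟪θ, T x⟫ - c))))
  rw [withDensity_apply _ MeasurableSet.univ, Measure.restrict_univ,
    ← ofReal_integral_eq_lintegral_ofReal] at hu
  · simp_rw [h1] at hu
    rw [integral_const_mul] at hu
    have : Real.exp (-c) * laplace ρ h T θ = 1 := by
      have := congrArg ENNReal.toReal hu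
      rwa [ENNReal.toReal_ofReal, ENNReal.toReal_one] at this
      exact mul_nonneg (Real.exp_pos _).le
        (integral_nonneg fun x => mul_nonneg (h0 x) (Real.exp_pos _).le)
    rw [Real.exp_neg] at this
    field_simp at this
    exact this
  · simp_rw [h1]; exact hθ.const_mul _
  · exact ae_of_all _ fun x => mul_nonneg (h0 x) (Real.exp_pos _).le

/-- A power of the density ratio is again an exponential tilt, so its moment is the Laplace
transform at the parameter extrapolated along the line from `θ` to `θ'`. -/
lemma integral_rnDeriv_rpow_expFamily (hm : Measurable h) (h0 : ∀ x, 0 ≤ h x) (hT : Measurable T)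
    {θ θ' : Vec d} {c c' : ℝ} {Q Q' : Measure X} [IsProbabilityMeasure Q]
    (hQ : Q = ρ.withDensity (fun x => ENNReal.ofReal (h x * Real.exp (⟪θ, T x⟫ - c))))
    (hQ' : Q' = ρ.withDensity (fun x => ENNReal.ofReal (h x * Real.exp (⟪θ', T x⟫ - c'))))
    {p : ℝ} (hp : θ + p • (θ' - θ) ∈ naturalSet ρ h T) :
    Q' ≪ Q ∧ Integrable (fun x => (Q'.rnDeriv Q x).toReal ^ p) Q ∧
      ∫ x, (Q'.rnDeriv Q x).toReal ^ p ∂Q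
        = laplace ρ h T (θ + p • (θ' - θ)) * Real.exp (-(c + p * (c' - c))) := by
  have hQQ : Q' = Q.withDensity
      (fun x => ENNReal.ofReal (Real.exp (⟪θ' - θ, T x⟫ - (c' - c)))) := by
    rw [hQ, hQ']; exact withDensity_expFamily_eq hm h0 hT θ θ' c c'
  have hae : (fun x => (Q'.rnDeriv Q x).toReal ^ p)
      =ᵐ[Q] fun x => Real.exp (p * (⟪θ' - θ, T x⟫ - (c' - c))) := by
    have := Measure.rnDeriv_withDensity Q
      (f := fun x => ENNReal.ofReal (Real.exp (⟪θ' - θ, T x⟫ - (c' - c)))) (by fun_prop)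
    rw [← hQQ] at this
    filter_upwards [this] with x hx
    rw [hx, ENNReal.toReal_ofReal (Real.exp_pos _).le, ← Real.exp_mul, mul_comm]
  have hdens : ∀ x, (ENNReal.ofReal (h x * Real.exp (⟪θ, T x⟫ - c))).toReal
      • Real.exp (p * (⟪θ' - θ, T x⟫ - (c' - c)))
      = Real.exp (-(c + p * (c' - c))) * (h x * Real.exp ⟪θ + p • (θ' - θ), T x⟫) := by
    intro x
    rw [ENNReal.toReal_ofReal (mul_nonneg (h0 x) (Real.exp_pos _).le), smul_eq_mul, mul_assoc,
      ← Real.exp_add, mul_left_comm, ← Real.exp_add, inner_add_left, real_inner_smul_left]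
    congr 2
    ring
  have hmeas : Measurable fun x => ENNReal.ofReal (h x * Real.exp (⟪θ, T x⟫ - c)) := by fun_prop
  refine ⟨hQQ ▸ withDensity_absolutelyContinuous _ _, ?_, ?_⟩
  · rw [integrable_congr hae, hQ, integrable_withDensity_iff_integrable_smul' hmeas
      (ae_of_all _ fun x => ENNReal.ofReal_lt_top)]
    simp_rw [hdens]
    exact hp.const_mul _
  · rw [integral_congr_ae hae, hQ, integral_withDensity_eq_integral_toReal_smul hmeas
      (ae_of_all _ fun x => ENNReal.ofReal_lt_top)]
    simp_rw [hdens]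
    rw [integral_const_mul, mul_comm, laplace]

end Laplace

lemma IsMeanExpFamily.exists_nhds_projKL {L : ℕ} {D : Set (Vec L)} {P : Vec L → Measure (Vec L)}
    (hP : IsMeanExpFamily D P) {S : Set (Vec L)} (hS : IsCompact S) (hSD : S ⊆ D)
    {m₀ : Vec L} (hm₀ : m₀ ∈ D) {ε : ℝ} (hε : 0 < ε) :
    ∃ U ∈ 𝓝 m₀, ∃ B : ℝ, ∀ m ∈ U, m ∈ D ∧ ∀ n ∈ S, ∀ z : Vec L,
      projKL P z m n ≤ ENNReal.ofReal B ∧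
      ∀ m' ∈ U, projKL P z m n ≤ projKL P z m' n + ENNReal.ofReal ε := by
  obtain ⟨hDo, d, h, T, η, ψ, hm, h0, hT, hη, hfam⟩ := hP
  set Θ := naturalSet volume h T with hΘ
  set Λ := laplace volume h T with hΛ
  have hηΘ : ∀ m ∈ D, η m ∈ interior Θ := fun m hmD => (hfam m hmD).2.1
  have hηc : ∀ m ∈ D, ContinuousAt η m := fun m hmD => hη.continuousAt (hDo.mem_nhds hmD)
  have hψ : ∀ m ∈ D, Λ (η m) = Real.exp (ψ m) := by
    intro m hmD
    obtain ⟨e, hi, hpr, -⟩ := hfam m hmD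
    rw [e] at hpr
    exact exp_eq_laplace h0 (interior_subset hi)
  -- Normalisation forces `ψ` to be the log-Laplace transform at `η`, which is continuous since a
  -- convex function is continuous in the interior of its domain.
  have hψc : ∀ m ∈ D, ContinuousAt ψ m := by
    intro m hmD
    have h1 : ContinuousAt (fun m => Real.log (Λ (η m))) m := by
      refine ContinuousAt.log ?_ (by rw [hψ m hmD]; exact (Real.exp_pos _).ne')
      exact ContinuousAt.comp (g := Λ) (continuousAt_laplace hm h0 hT (hηΘ m hmD)) (hηc m hmD)
    refine h1.congr ?_
    filter_upwards [hDo.mem_nhds hmD] with m' hm'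
    rw [hψ m' hm', Real.log_exp]
  -- bounds on the compact set
  obtain ⟨H, hH⟩ := hS.exists_bound_of_continuousOn (hη.mono hSD)
  obtain ⟨Ψ, hΨ⟩ := hS.exists_bound_of_continuousOn
    (f := ψ) (fun m hmS => (hψc m (hSD hmS)).continuousWithinAt)
  set θ₀ := η m₀ with hθ₀
  have hΛc := continuousAt_laplace hm h0 hT (hηΘ m₀ hm₀)
  obtain ⟨r, hr, hball⟩ : ∃ r > 0, ∀ θ ∈ Metric.ball θ₀ r, θ ∈ Θ ∧ Λ θ ≤ Λ θ₀ + 1 := by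
    have h1 : ∀ᶠ θ in 𝓝 θ₀, θ ∈ Θ ∧ Λ θ ≤ Λ θ₀ + 1 :=
      Filter.Eventually.and (mem_interior_iff_mem_nhds.1 (hηΘ m₀ hm₀))
        (hΛc.eventually_le_const (by simp [hΛ, hθ₀]))
    exact Metric.eventually_nhds_iff_ball.1 h1
  set H' := ‖θ₀‖ + r + |H| + 1 with hH'
  have hH'0 : 0 < H' := by positivity
  -- The parameter for the moment of order `1 + a` overshoots `η m` by `a • (η m - η n)`, of norm at
  -- most `a * H' = r / 4`. With `η m` within `r / 2` of `θ₀` it stays in the ball of radius `r`.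
  set a := r / (4 * H') with ha
  have ha0 : 0 < a := by positivity
  set S₀ := (Λ θ₀ + 1) * Real.exp ((1 + a) * (|ψ m₀| + 1) + a * |Ψ|) with hS₀
  set B := √(4 / a ^ 2 * S₀ + 4) with hB
  have hB0 : 0 < B := by
    have : 0 < Λ θ₀ := by rw [hψ m₀ hm₀]; exact Real.exp_pos _
    exact Real.sqrt_pos.2 (by positivity)
  -- Makes the error term `√χ * B` of `klDiv_le_klDiv_add` equal to `ε`.
  set χ := (ε / B) ^ 2 with hχ
  have hχ0 : 0 < χ := by positivity
  have hχB : √χ * B = ε := by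
    rw [hχ, Real.sqrt_sq (by positivity)]; field_simp
  -- the neighbourhood
  have hη1 : ∀ᶠ m in 𝓝 m₀, ‖η m - θ₀‖ < r / 2 := by
    have := (hηc m₀ hm₀).eventually (Metric.ball_mem_nhds θ₀ (half_pos hr))
    filter_upwards [this] with m h1
    rwa [← dist_eq_norm]
  have hψ1 : ∀ᶠ m in 𝓝 m₀, |ψ m - ψ m₀| < 1 := by
    have := (hψc m₀ hm₀).eventually (Metric.ball_mem_nhds (ψ m₀) one_pos)
    filter_upwards [this] with m h1
    rwa [← Real.dist_eq]
  -- On the diagonal point `(m₀, m₀)` the parameter is `θ₀` and the second moment is `1`, so this is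
  -- continuity there.
  have hχ1 : ∀ᶠ q : Vec L × Vec L in 𝓝 m₀ ×ˢ 𝓝 m₀,
      η q.1 + (2 : ℝ) • (η q.2 - η q.1) ∈ Θ ∧
      Λ (η q.1 + (2 : ℝ) • (η q.2 - η q.1)) * Real.exp (-(ψ q.1 + 2 * (ψ q.2 - ψ q.1)))
        ≤ 1 + χ := by
    rw [← nhds_prod_eq]
    have e1 : ContinuousAt (fun q : Vec L × Vec L => η q.1) (m₀, m₀) :=
      ContinuousAt.comp (g := η) (hηc m₀ hm₀) continuousAt_fst
    have e2 : ContinuousAt (fun q : Vec L × Vec L => η q.2) (m₀, m₀) :=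
      ContinuousAt.comp (g := η) (hηc m₀ hm₀) continuousAt_snd
    have p1 : ContinuousAt (fun q : Vec L × Vec L => ψ q.1) (m₀, m₀) :=
      ContinuousAt.comp (g := ψ) (hψc m₀ hm₀) continuousAt_fst
    have p2 : ContinuousAt (fun q : Vec L × Vec L => ψ q.2) (m₀, m₀) :=
      ContinuousAt.comp (g := ψ) (hψc m₀ hm₀) continuousAt_snd
    have e3 : ContinuousAt (fun q : Vec L × Vec L => η q.1 + (2 : ℝ) • (η q.2 - η q.1)) (m₀, m₀) :=
      by fun_prop
    have e3v : η m₀ + (2 : ℝ) • (η m₀ - η m₀) = θ₀ := by simp [hθ₀]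
    have hΛc' : ContinuousAt Λ (η m₀ + (2 : ℝ) • (η m₀ - η m₀)) := by rw [e3v]; exact hΛc
    have e4 : ContinuousAt
        (fun q : Vec L × Vec L => Λ (η q.1 + (2 : ℝ) • (η q.2 - η q.1))) (m₀, m₀) :=
      ContinuousAt.comp (g := Λ) (x := (m₀, m₀)) hΛc' e3
    have e5 : ContinuousAt (fun q : Vec L × Vec L =>
        Real.exp (-(ψ q.1 + 2 * (ψ q.2 - ψ q.1)))) (m₀, m₀) := by
      exact Real.continuous_exp.continuousAt.comp (p1.add ((p2.sub p1).const_mul 2)).neg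
    refine Filter.Eventually.and ?_ ?_
    · refine e3.eventually (p := fun θ => θ ∈ Θ) ?_
      simp only [e3v]
      exact mem_interior_iff_mem_nhds.1 (hηΘ m₀ hm₀)
    · refine (e4.mul e5).eventually_le_const ?_
      simp only [sub_self, mul_zero, add_zero, smul_zero, Pi.mul_apply]
      rw [hψ m₀ hm₀, ← Real.exp_add]
      simp [hχ0]
  obtain ⟨U₁, hU₁, hU₁'⟩ := Filter.eventually_prod_self_iff'.1 hχ1
  refine ⟨D ∩ ({m | ‖η m - θ₀‖ < r / 2} ∩ ({m | |ψ m - ψ m₀| < 1} ∩ {m | U₁ m})),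
    inter_mem (hDo.mem_nhds hm₀) (inter_mem hη1 (inter_mem hψ1 hU₁)), B, ?_⟩
  rintro m ⟨hmD, hm1, hm2, hm3⟩
  refine ⟨hmD, fun n hn z => ?_⟩
  obtain ⟨hPm, -, hprm, -⟩ := hfam m hmD
  obtain ⟨hPn, -, hprn, -⟩ := hfam n (hSD hn)
  have hz : Measurable fun x : Vec L => ⟪z, x⟫ := by fun_prop
  have hball' : η n + (1 + a) • (η m - η n) ∈ Metric.ball θ₀ r := by
    rw [Metric.mem_ball, dist_eq_norm]
    have : η n + (1 + a) • (η m - η n) - θ₀ = (η m - θ₀) + a • ((η m - θ₀) + θ₀ - η n) := by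
      module
    rw [this]
    have h1 : ‖(η m - θ₀) + θ₀ - η n‖ ≤ H' := by
      refine (norm_sub_le _ _).trans ((add_le_add_left (norm_add_le _ _) _).trans ?_)
      have := (hH n hn).trans (le_abs_self H)
      have h3 : ‖η m - θ₀‖ < r / 2 := hm1
      linarith
    calc _ ≤ ‖η m - θ₀‖ + a * H' := by
          refine (norm_add_le _ _).trans ?_
          rw [norm_smul, Real.norm_of_nonneg ha0.le]
          gcongr
      _ < r / 2 + r / 4 := by
          have : a * H' = r / 4 := by rw [ha]; field_simp
          rw [this]
          exact add_lt_add_left hm1 _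
      _ < r := by linarith
  obtain ⟨hac, hint, hval⟩ := integral_rnDeriv_rpow_expFamily hm h0 hT hPn hPm (hball _ hball').1
  have hval' : ∫ x, ((P m).rnDeriv (P n) x).toReal ^ (1 + a) ∂(P n) ≤ S₀ := by
    rw [hval, hS₀]
    have hexp : -(ψ n + (1 + a) * (ψ m - ψ n)) ≤ (1 + a) * (|ψ m₀| + 1) + a * |Ψ| := by
      have h1 : -ψ m ≤ |ψ m₀| + 1 := by
        have : |ψ m - ψ m₀| < 1 := hm2
        linarith [abs_lt.1 this, neg_abs_le (ψ m₀)]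
      have h2 : ψ n ≤ |Ψ| := (le_abs_self _).trans ((hΨ n hn).trans (le_abs_self Ψ))
      nlinarith [mul_le_mul_of_nonneg_left h1 (by linarith : (0:ℝ) ≤ 1 + a),
        mul_le_mul_of_nonneg_left h2 ha0.le]
    have hpos : 0 ≤ Λ (η n + (1 + a) • (η m - η n)) :=
      integral_nonneg fun x => mul_nonneg (h0 x) (Real.exp_pos _).le
    exact mul_le_mul (hball _ hball').2 (Real.exp_le_exp.2 hexp) (Real.exp_pos _).le
      (hpos.trans (hball _ hball').2)
  refine ⟨klDiv_map_le_of_integrable_rpow hac hz ha0 hint hval', ?_⟩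
  rintro m' ⟨hmD', hm1', hm2', hm3'⟩
  obtain ⟨hPm', -, hprm', -⟩ := hfam m' hmD'
  obtain ⟨hx1, hx2⟩ := hU₁' m hm3 m' hm3'
  obtain ⟨hac', hint', hval2⟩ := integral_rnDeriv_rpow_expFamily hm h0 hT hPm hPm' hx1
  simp only [Real.rpow_two] at hint' hval2
  have := klDiv_map_le_klDiv_map_add (χ := χ) hac hac' hz ha0 hint hval' hint' (hval2.trans_le hx2)
  rw [← hB, hχB] at this
  exact this


/-! ### Local constancy of the relaxed alternating set -/

section Structure

variable {L K : ℕ}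

lemma inner_mulVec (z : Vec L) (M : Inst L K) (p : Fin K → ℝ) :
    ⟪z, M.mulVec p⟫ = ∑ k, p k * ⟪z, M k⟫ := by
  simp [Inst.mulVec, inner_sum, real_inner_smul_right]

lemma mulVec_single (M : Inst L K) (k : Fin K) : M.mulVec (Pi.single k 1) = M k := by
  simp [Inst.mulVec, Pi.single_apply, ite_smul]

lemma mulVec_sub (M : Inst L K) (p q : Fin K → ℝ) :
    M.mulVec (p - q) = M.mulVec p - M.mulVec q := by
  simp [Inst.mulVec, sub_smul, Finset.sum_sub_distrib]

lemma closedConvexHull_altBoundary_subset (C : Set (Vec L)) (Mmin Mmax : ℝ) (p : Fin K → ℝ) :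
    (closedConvexHull ℝ (altBoundary C Mmin Mmax p) : Set (Inst L K))
      ⊆ instSet L K Mmin Mmax := by
  have e : instSet L K Mmin Mmax
      = ⋂ k, ⋂ l, (fun M : Inst L K => M k l) ⁻¹' Icc Mmin Mmax := by
    ext M; simp [instSet]
  refine closedConvexHull_min (fun N hN => hN.1) ?_ ?_
  · intro N hN N' hN' a b ha hb hab k l
    exact (convex_Icc Mmin Mmax) (hN k l) (hN' k l) ha hb hab
  · rw [e]
    refine isClosed_iInter fun k => isClosed_iInter fun l => isClosed_Icc.preimage ?_
    fun_prop

/-- `M` is then an admissible alternative to itself, at zero divergence. The contrapositive extracts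
structure from a positive value. -/
lemma relaxedValue_eq_zero {C : Set (Vec L)} {Mmin Mmax : ℝ} {P : Vec L → Measure (Vec L)}
    {w : Fin K → ℝ} {M : Inst L K} (hP : ∀ k, IsProbabilityMeasure (P (M k)))
    {p : Fin K → ℝ} (hp : p ∈ paretoPolicies C M) (hM : M ∈ altBoundary C Mmin Mmax p) :
    relaxedValue C Mmin Mmax P w M = 0 := by
  obtain ⟨-, -, -, -, z, hz, hz0, -⟩ := id hM
  refine le_antisymm ((iInf₂_le p hp).trans ((iInf₂_le M
    (subset_closedConvexHull hM)).trans
    ((iInf₂_le z ⟨hz, hz0⟩).trans ?_))) bot_le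
  refine (Finset.sum_eq_zero fun k _ => ?_).le
  have := Measure.isProbabilityMeasure_map (μ := P (M k)) (f := fun x : Vec L => ⟪z, x⟫)
    (by fun_prop)
  rw [projKL, klDiv_self, mul_zero]

/-- When all preferences are allowed, testing with the difference of the two reward vectors shows
that domination forces equality. -/
lemma paretoPolicies_univ (M : Inst L K) : paretoPolicies univ M = stdSimplex ℝ (Fin K) := by
  ext p
  refine ⟨fun h => h.1, fun h => ⟨h, ?_⟩⟩
  rintro ⟨q, -, hle, hne⟩
  have := hle (M.mulVec p - M.mulVec q) (mem_univ _)
  exact hne (sub_eq_zero.1 (real_inner_self_nonpos.1 this))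

/-- With two arms `p' - p` is a nonzero multiple of `(1, -1)`, so the condition says that `z` does
not separate the two arms, whatever `p` is. With fewer arms there is no competing policy. -/
lemma altBoundary_subset_of_le_two (hK : K ≤ 2) {C : Set (Vec L)} {Mmin Mmax : ℝ}
    {p q : Fin K → ℝ} (hp : p ∈ stdSimplex ℝ (Fin K)) (hq : q ∈ stdSimplex ℝ (Fin K)) :
    altBoundary C Mmin Mmax p ⊆ altBoundary C Mmin Mmax q := by
  rintro N ⟨hN, p', hp', hne, z, hz, hz0, h⟩
  interval_cases K
  · exact absurd (Subsingleton.elim _ _) hne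
  · refine absurd ?_ hne
    have h1 := hp.2
    have h2 := hp'.2
    simp only [Finset.univ_unique, Finset.sum_singleton] at h1 h2
    ext i
    rw [Subsingleton.elim i default, h1, h2]
  · have h1 := hp.2
    have h2 := hp'.2
    have h3 := hq.2
    rw [inner_mulVec] at h
    simp only [Fin.sum_univ_two, Pi.sub_apply] at h1 h2 h3 h
    have hd : p' 0 - p 0 ≠ 0 := by
      intro h0
      refine hne (funext fun i => ?_)
      fin_cases i
      · show p' 0 = p 0
        linarith
      · show p' 1 = p 1
        linarith
    have hc : ⟪z, N 0⟫ = ⟪z, N 1⟫ := by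
      have : (p' 0 - p 0) * (⟪z, N 0⟫ - ⟪z, N 1⟫) = 0 := by
        rw [show p' 1 - p 1 = -(p' 0 - p 0) by linarith] at h
        linarith
      exact sub_eq_zero.1 ((mul_eq_zero.1 this).resolve_left hd)
    have key : ∀ q' ∈ stdSimplex ℝ (Fin 2), ⟪z, N.mulVec (q' - q)⟫ = 0 := by
      intro q' hq'
      have h4 := hq'.2
      rw [inner_mulVec]
      simp only [Fin.sum_univ_two, Pi.sub_apply] at h4 ⊢
      rw [hc]
      linear_combination (⟪z, N 1⟫) * (h4 - h3)
    -- Every policy now satisfies the equation; a vertex different from `q` serves as the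
    -- competitor.
    by_cases h0 : q = Pi.single 0 1
    · refine ⟨hN, Pi.single 1 1, single_mem_stdSimplex ℝ 1, ?_, z, hz, hz0,
        key _ (single_mem_stdSimplex ℝ 1)⟩
      rw [h0]
      intro h
      simpa using congrFun h 0
    · exact ⟨hN, Pi.single 0 1, single_mem_stdSimplex ℝ 0, Ne.symm h0, z, hz, hz0,
        key _ (single_mem_stdSimplex ℝ 0)⟩

lemma altBoundary_eq_empty_of_isEmpty (hL : L = 0) {C : Set (Vec L)} {Mmin Mmax : ℝ}
    (p : Fin K → ℝ) : altBoundary C Mmin Mmax p = ∅ := by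
  subst hL
  refine eq_empty_of_forall_notMem ?_
  rintro N ⟨-, -, -, -, z, -, hz0, -⟩
  exact hz0 (Subsingleton.elim _ _)

/-- Two linear constraints on three weights have a common non-zero solution. -/
lemma exists_ne_zero_sum_eq_zero (x y z : ℝ) :
    ∃ a b c : ℝ, (a ≠ 0 ∨ b ≠ 0 ∨ c ≠ 0) ∧ a + b + c = 0 ∧ a * x + b * y + c * z = 0 := by
  by_cases h : x = y
  · exact ⟨1, -1, 0, by simp, by ring, by rw [h]; ring⟩
  · exact ⟨y - z, z - x, x - y, Or.inr (Or.inr (sub_ne_zero.2 h)), by ring, by ring⟩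

/-- The uniform policy is interior to the simplex, so any small direction of zero sum may be added
to it. Three arms leave a nonzero such direction orthogonal to the scalarised rewards. -/
lemma mem_altBoundary_uniform (hK : 3 ≤ K) (hL : 0 < L) {Mmin Mmax : ℝ} {M : Inst L K}
    (hM : M ∈ instSet L K Mmin Mmax) :
    M ∈ altBoundary univ Mmin Mmax (fun _ => (K : ℝ)⁻¹) := by
  set z : Vec L := EuclideanSpace.single ⟨0, hL⟩ 1 with hz
  have hz0 : z ≠ 0 := by
    intro h
    have := congrArg (fun v : Vec L => v ⟨0, hL⟩) h
    simp [hz] at this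
  let i : Fin K := ⟨0, by omega⟩
  let j : Fin K := ⟨1, by omega⟩
  let k : Fin K := ⟨2, by omega⟩
  have hij : i ≠ j := by simp [i, j]
  have hik : i ≠ k := by simp [i, k]
  have hjk : j ≠ k := by simp [j, k]
  obtain ⟨a, b, c, hne, hsum, hlin⟩ := exists_ne_zero_sum_eq_zero ⟪z, M i⟫ ⟪z, M j⟫ ⟪z, M k⟫
  set e : Fin K → ℝ := Pi.single i a + Pi.single j b + Pi.single k c with he
  have hK0 : (0 : ℝ) < K := by exact_mod_cast (by omega : 0 < K)
  have hele : ∀ x, |e x| ≤ |a| + |b| + |c| := by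
    intro x
    have hs : ∀ (i : Fin K) (a : ℝ), |(Pi.single i a : Fin K → ℝ) x| ≤ |a| := by
      intro i a
      rw [Pi.single_apply]
      split_ifs <;> simp
    simp only [he, Pi.add_apply]
    exact (abs_add_three _ _ _).trans (add_le_add (add_le_add (hs _ _) (hs _ _)) (hs _ _))
  set t : ℝ := 1 / (K * (1 + (|a| + |b| + |c|))) with ht
  have ht0 : 0 < t := by positivity
  have hte : ∀ x, |t * e x| ≤ (K : ℝ)⁻¹ := by
    intro x
    rw [abs_mul, abs_of_pos ht0]
    calc t * |e x| ≤ t * (1 + (|a| + |b| + |c|)) := by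
          gcongr
          linarith [hele x]
      _ = (K : ℝ)⁻¹ := by rw [ht]; field_simp
  have hesum : ∑ x, e x = 0 := by
    simp [he, Finset.sum_add_distrib, hsum]
  have hne' : t • e ≠ 0 := by
    intro h
    have h0 : e = 0 := (smul_eq_zero.1 h).resolve_left ht0.ne'
    have hi := congrFun h0 i
    have hj := congrFun h0 j
    have hk := congrFun h0 k
    simp [he, hij, hik, hjk, hij.symm, hik.symm, hjk.symm] at hi hj hk
    simp [hi, hj, hk] at hne
  refine ⟨hM, (fun _ => (K : ℝ)⁻¹) + t • e, ⟨fun x => ?_, ?_⟩, ?_, z, mem_univ _, hz0, ?_⟩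
  · simp only [Pi.add_apply, Pi.smul_apply, smul_eq_mul]
    linarith [neg_abs_le (t * e x), hte x]
  · simp only [Pi.add_apply, Pi.smul_apply, smul_eq_mul, Finset.sum_add_distrib,
      ← Finset.mul_sum, hesum]
    simp [hK0.ne']
  · intro h
    exact hne' (by simpa using h)
  · rw [add_sub_cancel_left, inner_mulVec]
    simp only [Pi.smul_apply, smul_eq_mul, he, Pi.add_apply, mul_assoc, ← Finset.mul_sum, add_mul,
      Finset.sum_add_distrib, Pi.single_apply, ite_mul, zero_mul, Finset.sum_ite_eq',
      Finset.mem_univ, if_true]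
    rw [hlin, mul_zero]

/-- Linear independence allows the value `1` to be prescribed on every row; this yields an interior
point of the cone. -/
lemma exists_inner_eq_one {n : ℕ} {A : Fin n → Vec L} (hA : LinearIndependent ℝ A) :
    ∃ z : Vec L, ∀ i, ⟪A i, z⟫ = 1 := by
  obtain ⟨f, hf⟩ := LinearMap.exists_extend
    ((Module.Basis.span hA).constr ℝ (fun _ => (1 : ℝ)))
  refine ⟨(InnerProductSpace.toDual ℝ (Vec L)).symm (LinearMap.toContinuousLinearMap f),
    fun i => ?_⟩
  rw [real_inner_comm, InnerProductSpace.toDual_symm_apply]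
  have h1 := (Module.Basis.span hA).constr_basis ℝ (fun _ => (1 : ℝ)) i
  rw [← hf] at h1
  simpa [Module.Basis.span_apply] using h1

lemma sum_mul_inner_nonneg {M : Inst L K} {k : Fin K} {z : Vec L}
    (h : ∀ j, 0 ≤ ⟪z, M k - M j⟫) {p : Fin K → ℝ} (hp : p ∈ stdSimplex ℝ (Fin K)) :
    ⟪z, M k - M.mulVec p⟫ = ∑ j, p j * ⟪z, M k - M j⟫ ∧ 0 ≤ ⟪z, M k - M.mulVec p⟫ := by
  have e : ⟪z, M k - M.mulVec p⟫ = ∑ j, p j * ⟪z, M k - M j⟫ := by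
    rw [inner_sub_right, inner_mulVec]
    simp only [inner_sub_right, mul_sub, Finset.sum_sub_distrib, ← Finset.sum_mul, hp.2, one_mul]
  exact ⟨e, e ▸ Finset.sum_nonneg fun j _ => mul_nonneg (hp.1 j) (h j)⟩

/-- An arm that is strictly preferred to the other arms for all preferences is the only Pareto
optimal policy. -/
lemma paretoPolicies_eq_singleton {C : Set (Vec L)} {z₀ : Vec L} (hz₀ : z₀ ∈ C) (hz₀' : z₀ ≠ 0)
    {M : Inst L K} {k : Fin K} (h : ∀ z ∈ C, z ≠ 0 → ∀ j ≠ k, 0 < ⟪z, M k - M j⟫) :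
    paretoPolicies C M = {Pi.single k 1} := by
  have h0 : ∀ z ∈ C, ∀ j, 0 ≤ ⟪z, M k - M j⟫ := by
    intro z hz j
    by_cases hz0 : z = 0
    · simp [hz0]
    by_cases hj : j = k
    · simp [hj]
    · exact (h z hz hz0 j hj).le
  have hpos : ∀ p ∈ stdSimplex ℝ (Fin K), p ≠ Pi.single k 1 → 0 < ⟪z₀, M k - M.mulVec p⟫ := by
    intro p hp hne
    obtain ⟨j, hjk, hj⟩ : ∃ j, j ≠ k ∧ 0 < p j := by
      by_contra! hcon
      have hz : ∀ j, j ≠ k → p j = 0 := fun j hj => le_antisymm (hcon j hj) (hp.1 j)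
      refine hne (funext fun j => ?_)
      by_cases hj : j = k
      · subst hj
        rw [Pi.single_eq_same, ← hp.2, Finset.sum_eq_single j (fun b _ hb => hz b hb) (by simp)]
      · rw [hz j hj, Pi.single_eq_of_ne hj]
    rw [(sum_mul_inner_nonneg (h0 z₀ hz₀) hp).1]
    exact Finset.sum_pos' (fun j _ => mul_nonneg (hp.1 j) (h0 z₀ hz₀ j))
      ⟨j, Finset.mem_univ _, mul_pos hj (h z₀ hz₀ hz₀' j hjk)⟩
  ext p
  rw [mem_singleton_iff]
  constructor
  · rintro ⟨hp, hnd⟩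
    by_contra hne
    refine hnd ⟨Pi.single k 1, single_mem_stdSimplex ℝ k, fun z hz => ?_, fun he => ?_⟩
    · rw [mulVec_single, ← neg_sub, inner_neg_right]
      linarith [(sum_mul_inner_nonneg (h0 z hz) hp).2]
    · have := hpos p hp hne
      rw [he, mulVec_single] at this
      simp at this
  · rintro rfl
    refine ⟨single_mem_stdSimplex ℝ k, ?_⟩
    rintro ⟨q, hq, hle, hne⟩
    rw [mulVec_single] at hle hne
    have h1 := hle z₀ hz₀
    by_cases hqk : q = Pi.single k 1
    · rw [hqk, mulVec_single] at hne
      exact hne rfl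
    · linarith [hpos q hq hqk]

lemma isClosed_cone {n : ℕ} (A : Fin n → Vec L) : IsClosed {x : Vec L | ∀ i, 0 ≤ ⟪A i, x⟫} := by
  rw [ofPred_forall]
  exact isClosed_iInter fun i => isClosed_le continuous_const (by fun_prop)

/-- A strict preference for all `z ∈ C` is stable under perturbation. -/
lemma exists_forall_inner_pos {n : ℕ} {A : Fin n → Vec L} {M : Inst L K} {k : Fin K}
    (h : ∀ z ∈ {x : Vec L | ∀ i, 0 ≤ ⟪A i, x⟫}, z ≠ 0 → ∀ j ≠ k, 0 < ⟪z, M k - M j⟫) :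
    ∃ ξ > 0, ∀ M' : Inst L K, (∀ j, ‖M' j - M j‖ ≤ ξ) →
      ∀ z ∈ {x : Vec L | ∀ i, 0 ≤ ⟪A i, x⟫}, z ≠ 0 → ∀ j ≠ k, 0 < ⟪z, M' k - M' j⟫ := by
  set C := {x : Vec L | ∀ i, 0 ≤ ⟪A i, x⟫} with hC
  have hcpt : IsCompact (C ∩ Metric.sphere (0 : Vec L) 1) :=
    (isCompact_sphere _ _).inter_left (isClosed_cone A)
  have hγ : ∀ j, ∃ γ > 0, j ≠ k → ∀ z ∈ C ∩ Metric.sphere (0 : Vec L) 1, γ ≤ ⟪z, M k - M j⟫ := by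
    intro j
    by_cases hj : j = k
    · exact ⟨1, one_pos, fun h => absurd hj h⟩
    rcases (C ∩ Metric.sphere (0 : Vec L) 1).eq_empty_or_nonempty with he | hne
    · exact ⟨1, one_pos, fun _ z hz => by rw [he] at hz; exact hz.elim⟩
    obtain ⟨z, hz, hmin⟩ := hcpt.exists_isMinOn hne
      (f := fun z => ⟪z, M k - M j⟫) (by fun_prop)
    refine ⟨⟪z, M k - M j⟫, h z hz.1 ?_ j hj, fun _ z' hz' => hmin hz'⟩
    exact Metric.ne_of_mem_sphere hz.2 one_ne_zero
  choose γ hγ0 hγ using hγ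
  obtain ⟨γ₀, hγ₀, hγ₀'⟩ : ∃ γ₀ > 0, ∀ j, γ₀ ≤ γ j := by
    have hne : (Finset.univ : Finset (Fin K)).Nonempty := ⟨k, Finset.mem_univ _⟩
    obtain ⟨j, -, hj⟩ := Finset.exists_min_image Finset.univ γ hne
    exact ⟨γ j, hγ0 j, fun i => hj i (Finset.mem_univ _)⟩
  -- Two columns move by at most `γ₀ / 3` each, which leaves a margin of `γ₀ / 3` on the unit
  -- sphere.
  refine ⟨γ₀ / 3, by positivity, fun M' hM' z hz hz0 j hj => ?_⟩
  have hn : 0 < ‖z‖ := norm_pos_iff.2 hz0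
  have hu : ‖z‖⁻¹ • z ∈ C ∩ Metric.sphere (0 : Vec L) 1 := by
    refine ⟨fun i => ?_, ?_⟩
    · rw [real_inner_smul_right]
      exact mul_nonneg (by positivity) (hz i)
    · rw [mem_sphere_zero_iff_norm, norm_smul, norm_inv, norm_norm, inv_mul_cancel₀ hn.ne']
  have h1 := (hγ₀' j).trans (hγ j hj _ hu)
  rw [real_inner_smul_left] at h1
  have h2 : γ₀ * ‖z‖ ≤ ⟪z, M k - M j⟫ := by
    have := mul_le_mul_of_nonneg_left h1 hn.le
    rwa [mul_inv_cancel_left₀ hn.ne', mul_comm] at this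
  have h3 : ⟪z, M' k - M' j⟫ = ⟪z, M k - M j⟫ + ⟪z, (M' k - M k) - (M' j - M j)⟫ := by
    rw [← inner_add_right]; congr 1; abel
  have h4 : |⟪z, (M' k - M k) - (M' j - M j)⟫| ≤ ‖z‖ * (γ₀ / 3 + γ₀ / 3) :=
    (abs_real_inner_le_norm _ _).trans (by
      gcongr
      exact (norm_sub_le _ _).trans (add_le_add (hM' k) (hM' j)))
  have h5 := (abs_le.1 h4).1
  nlinarith [mul_pos hγ₀ hn]

/-- If the relaxed value is positive somewhere, then near `M` the set over which it is minimised
is the same for all instances and all their Pareto optimal policies. -/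
lemma exists_locally_constant_alternatives (hK : 0 < K) {C : Set (Vec L)} (hC : IsPreferenceCone C)
    {Mmin Mmax : ℝ} {P : Vec L → Measure (Vec L)} {w : Fin K → ℝ} {M : Inst L K}
    (hM : M ∈ instSet L K Mmin Mmax) (hP : ∀ k, IsProbabilityMeasure (P (M k)))
    (hw : relaxedValue C Mmin Mmax P w M ≠ 0) :
    ∃ A ⊆ instSet L K Mmin Mmax, ∃ ξ > 0, ∀ M' : Inst L K, (∀ k, ‖M' k - M k‖ ≤ ξ) →
      (paretoPolicies C M').Nonempty ∧ ∀ p ∈ paretoPolicies C M',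
        (closedConvexHull ℝ (altBoundary C Mmin Mmax p) : Set (Inst L K)) = A := by
  obtain ⟨n, A, hA, -, rfl⟩ := hC
  set C := {x : Vec L | ∀ i, 0 ≤ ⟪A i, x⟫} with hC
  -- Without constraints every policy is Pareto optimal, and for `L > 0` the uniform policy rules
  -- out three or more arms.
  rcases Nat.eq_zero_or_pos n with rfl | hn
  · have hCu : C = univ := by
      ext x; simp [hC]
    rw [hCu] at hw ⊢
    have hk : (Pi.single ⟨0, hK⟩ 1 : Fin K → ℝ) ∈ stdSimplex ℝ (Fin K) :=
      single_mem_stdSimplex ℝ _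
    have hind : ∀ p ∈ stdSimplex ℝ (Fin K), ∀ q ∈ stdSimplex ℝ (Fin K),
        altBoundary (univ : Set (Vec L)) Mmin Mmax p = altBoundary univ Mmin Mmax q := by
      intro p hp q hq
      rcases Nat.eq_zero_or_pos L with hL | hL
      · rw [altBoundary_eq_empty_of_isEmpty hL, altBoundary_eq_empty_of_isEmpty hL]
      rcases le_or_gt K 2 with h2 | h3
      · exact (altBoundary_subset_of_le_two h2 hp hq).antisymm
          (altBoundary_subset_of_le_two h2 hq hp)
      · refine absurd (relaxedValue_eq_zero hP ?_ (mem_altBoundary_uniform h3 hL hM)) hw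
        rw [paretoPolicies_univ]
        refine ⟨fun _ => by positivity, ?_⟩
        have : (K : ℝ) ≠ 0 := by exact_mod_cast hK.ne'
        simp [this]
    refine ⟨_, closedConvexHull_altBoundary_subset univ Mmin Mmax (Pi.single ⟨0, hK⟩ 1), 1, one_pos, fun M' _ => ?_⟩
    rw [paretoPolicies_univ]
    exact ⟨⟨_, hk⟩, fun p hp => by rw [hind p hp _ hk]⟩
  -- With constraints, an arm `k` that is best for the interior preference `z₀` turns out to be
  -- strictly best for all preferences.
  · obtain ⟨z₀, hz₀⟩ := exists_inner_eq_one hA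
    have hz₀C : z₀ ∈ C := fun i => by rw [hz₀]; norm_num
    have hz₀0 : z₀ ≠ 0 := by
      rintro rfl
      simpa using hz₀ ⟨0, hn⟩
    obtain ⟨k, -, hk⟩ := Finset.exists_max_image Finset.univ (fun k => ⟪z₀, M k⟫)
      ⟨⟨0, hK⟩, Finset.mem_univ _⟩
    have hk' : ∀ j, 0 ≤ ⟪z₀, M k - M j⟫ := fun j => by
      rw [inner_sub_right]; linarith [hk j (Finset.mem_univ _)]
    -- If `q` dominated, the difference `e` would be orthogonal to `z₀`. A small tilt `z₀ + c • e`
    -- stays in the cone and would give `c * ⟪e, e⟫ ≤ 0`.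
    have hkp : (Pi.single k 1 : Fin K → ℝ) ∈ paretoPolicies C M := by
      refine ⟨single_mem_stdSimplex ℝ k, ?_⟩
      rintro ⟨q, hq, hle, hne⟩
      rw [mulVec_single] at hle hne
      set e := M k - M.mulVec q with he
      have he0 : e ≠ 0 := sub_ne_zero.2 hne
      have h0 : ⟪z₀, e⟫ = 0 := le_antisymm (hle z₀ hz₀C) (sum_mul_inner_nonneg hk' hq).2
      obtain ⟨c, hc0, hc⟩ : ∃ c > 0, ∀ i, -(c * ⟪A i, e⟫) ≤ 1 := by
        obtain ⟨i, -, hi⟩ := Finset.exists_max_image Finset.univ (fun i => |⟪A i, e⟫|)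
          ⟨⟨0, hn⟩, Finset.mem_univ _⟩
        refine ⟨1 / (1 + |⟪A i, e⟫|), by positivity, fun j => ?_⟩
        have := hi j (Finset.mem_univ _)
        rw [← mul_neg, div_mul_eq_mul_div, div_le_one (by positivity)]
        linarith [neg_le_abs ⟪A j, e⟫]
      have h1 := hle (z₀ + c • e) (fun i => by
        rw [inner_add_right, hz₀, real_inner_smul_right]; linarith [hc i])
      rw [inner_add_left, h0, real_inner_smul_left, zero_add] at h1
      have h2 : 0 < ⟪e, e⟫ := real_inner_self_pos.2 he0
      nlinarith
    have hnm : M ∉ altBoundary C Mmin Mmax (Pi.single k 1) := fun h =>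
      hw (relaxedValue_eq_zero hP hkp h)
    have hne : ∀ z ∈ C, z ≠ 0 → ∀ j ≠ k, ⟪z, M k - M j⟫ ≠ 0 := by
      intro z hz hz0 j hj h
      refine hnm ⟨hM, Pi.single j 1, single_mem_stdSimplex ℝ j, ?_, z, hz, hz0, ?_⟩
      · intro h
        have := congrFun h j
        simp [hj] at this
      · rw [mulVec_sub, mulVec_single, mulVec_single, ← neg_sub, inner_neg_right, h, neg_zero]
    -- A sign change between `z₀` and `z` would put a zero at `(-b) • z₀ + a • z`, a nonzero point
    -- of the cone because `-b > 0` and `z₀` is interior.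
    have hpos : ∀ z ∈ C, z ≠ 0 → ∀ j ≠ k, 0 < ⟪z, M k - M j⟫ := by
      intro z hz hz0 j hj
      by_contra! hcon
      have hlt := lt_of_le_of_ne hcon (hne z hz hz0 j hj)
      set b := ⟪z, M k - M j⟫ with hb
      set a := ⟪z₀, M k - M j⟫ with ha
      have hmem : ∀ i, 0 < ⟪A i, (-b) • z₀ + a • z⟫ := by
        intro i
        rw [inner_add_right, real_inner_smul_right, real_inner_smul_right, hz₀]
        have := mul_nonneg (hk' j) (hz i)
        linarith
      refine hne ((-b) • z₀ + a • z) (fun i => (hmem i).le) ?_ j hj ?_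
      · intro h
        have := hmem ⟨0, hn⟩
        rw [h, inner_zero_right] at this
        exact lt_irrefl _ this
      · rw [inner_add_left, real_inner_smul_left, real_inner_smul_left, ← ha, ← hb]; ring
    obtain ⟨ξ, hξ, hξ'⟩ := exists_forall_inner_pos hpos
    refine ⟨_, closedConvexHull_altBoundary_subset C Mmin Mmax (Pi.single k 1), ξ, hξ,
      fun M' hM' => ?_⟩
    rw [paretoPolicies_eq_singleton hz₀C hz₀0 (hξ' M' hM')]
    exact ⟨singleton_nonempty _, fun p hp => by rw [mem_singleton_iff.1 hp]⟩

end Structure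


/-! ### The tracking rule -/

section Tracking

variable {L K : ℕ} {Ω : Type*} {arm : ℕ → Ω → Fin K} {v : ℕ → Ω → Fin K → ℝ} {ω : Ω}

lemma pulls_succ (arm : ℕ → Ω → Fin K) (t : ℕ) (ω : Ω) (k : Fin K) :
    pulls arm (t + 1) ω k = pulls arm t ω k + if arm t ω = k then 1 else 0 := by
  rw [pulls, Finset.range_add_one, Finset.filter_insert]
  split_ifs
  · rw [Finset.card_insert_of_notMem (by simp), pulls]
  · rw [pulls, add_zero]

lemma sum_pulls (arm : ℕ → Ω → Fin K) (t : ℕ) (ω : Ω) : ∑ k, pulls arm t ω k = t := by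
  induction t with
  | zero => simp [pulls]
  | succ t ih => simp [pulls_succ, Finset.sum_add_distrib, ih]

lemma pulls_le (arm : ℕ → Ω → Fin K) (t : ℕ) (ω : Ω) (k : Fin K) : pulls arm t ω k ≤ t :=
  (Finset.card_filter_le _ _).trans (by simp)

lemma pulls_le_sum_alloc (hv : ∀ t, v t ω ∈ stdSimplex ℝ (Fin K))
    (htrack : ∀ t, IsMinOn
      (fun k => (pulls arm t ω k : ℝ) - ∑ s ∈ Finset.range (t + 1), v s ω k) univ (arm t ω))
    (t : ℕ) (k : Fin K) :
    (pulls arm t ω k : ℝ) ≤ ∑ s ∈ Finset.range t, v s ω k + 1 := by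
  induction t with
  | zero => simp [pulls]
  | succ t ih =>
    rw [pulls_succ]
    by_cases hk : arm t ω = k
    · have hmin : ∀ j, (pulls arm t ω k : ℝ) - ∑ s ∈ Finset.range (t + 1), v s ω k
          ≤ pulls arm t ω j - ∑ s ∈ Finset.range (t + 1), v s ω j := fun j =>
        hk ▸ htrack t (mem_univ j)
      -- The allocations of `t + 1` rounds are compared with `t` pulls, so the smallest gap cannot
      -- be positive: the arm about to be pulled is not ahead.
      have hsum : ∑ j, ((pulls arm t ω j : ℝ) - ∑ s ∈ Finset.range (t + 1), v s ω j) = -1 := by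
        rw [Finset.sum_sub_distrib, ← Nat.cast_sum, sum_pulls, Finset.sum_comm]
        simp [(hv _).2]
      have hle : (pulls arm t ω k : ℝ) - ∑ s ∈ Finset.range (t + 1), v s ω k ≤ 0 := by
        by_contra! hcon
        have : (0 : ℝ) ≤ ∑ j, ((pulls arm t ω j : ℝ) - ∑ s ∈ Finset.range (t + 1), v s ω j) :=
          Finset.sum_nonneg fun j _ => hcon.le.trans (hmin j)
        linarith
      simp only [hk, if_true, Nat.cast_add, Nat.cast_one]
      linarith
    · simp only [hk, if_false, add_zero, Finset.sum_range_succ]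
      linarith [(hv t).1 k]

/-- The slacks in the upper bounds of all arms are nonnegative and add up to `K`, so no single arm
lags by more. -/
lemma sum_alloc_sub_le_pulls (hv : ∀ t, v t ω ∈ stdSimplex ℝ (Fin K))
    (htrack : ∀ t, IsMinOn
      (fun k => (pulls arm t ω k : ℝ) - ∑ s ∈ Finset.range (t + 1), v s ω k) univ (arm t ω))
    (t : ℕ) (k : Fin K) :
    ∑ s ∈ Finset.range t, v s ω k - K ≤ (pulls arm t ω k : ℝ) := by
  have h1 : ∑ j, (pulls arm t ω j : ℝ) = t := by exact_mod_cast sum_pulls arm t ω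
  have h2 : ∑ j, ∑ s ∈ Finset.range t, v s ω j = t := by
    rw [Finset.sum_comm]; simp [(hv _).2]
  have h3 : ∑ j, (∑ s ∈ Finset.range t, v s ω j + 1 - pulls arm t ω j) = K := by
    rw [Finset.sum_sub_distrib, Finset.sum_add_distrib, h1, h2]; simp
  have h4 := Finset.single_le_sum (f := fun j => ∑ s ∈ Finset.range t, v s ω j + 1
    - (pulls arm t ω j : ℝ)) (fun j _ => sub_nonneg.2 (pulls_le_sum_alloc hv htrack t j))
    (Finset.mem_univ k)
  rw [h3] at h4
  linarith

lemma explore_antitone (K : ℕ) (hK : 0 < K) : Antitone (explore K) := by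
  intro s t hst
  have hK' : (0 : ℝ) < K := by exact_mod_cast hK
  have : (s : ℝ) ≤ t := by exact_mod_cast hst
  unfold explore
  gcongr

lemma explore_pos (K : ℕ) (hK : 0 < K) (t : ℕ) : 0 < explore K t := by
  have hK' : (0 : ℝ) < K := by exact_mod_cast hK
  unfold explore
  positivity

lemma mul_explore_le_half (K : ℕ) (hK : 0 < K) (t : ℕ) : K * explore K t ≤ 1 / 2 := by
  have hK' : (0 : ℝ) < K := by exact_mod_cast hK
  calc K * explore K t ≤ K * explore K 0 := by
        gcongr
        exact explore_antitone K hK (Nat.zero_le t)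
    _ = 1 / 2 := by
        simp [explore, Real.sqrt_sq hK'.le]
        field_simp

lemma tendsto_explore (K : ℕ) : Tendsto (explore K) atTop (𝓝 0) := by
  unfold explore
  refine Tendsto.div_atTop tendsto_const_nhds ?_
  refine Tendsto.const_mul_atTop two_pos (Real.tendsto_sqrt_atTop.comp ?_)
  exact tendsto_atTop_add_const_left _ _ tendsto_natCast_atTop_atTop

lemma sqrt_le_mul_explore (K : ℕ) (hK : 0 < K) (t : ℕ) :
    √t / (2 * (K + 1)) ≤ t * explore K t := by
  have hK' : (1 : ℝ) ≤ K := by exact_mod_cast hK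
  rcases Nat.eq_zero_or_pos t with rfl | ht
  · simp
  have ht' : (1 : ℝ) ≤ t := by exact_mod_cast ht
  have hs : 1 ≤ √(t : ℝ) := Real.one_le_sqrt.2 ht'
  have hsq : √(t : ℝ) * √t = t := Real.mul_self_sqrt (by positivity)
  have h1 : √((K : ℝ) ^ 2 + t) ≤ (K + 1) * √t := by
    rw [Real.sqrt_le_left (by positivity)]
    nlinarith
  have h2 : 0 < √((K : ℝ) ^ 2 + t) := Real.sqrt_pos.2 (by positivity)
  rw [explore, mul_one_div, div_le_div_iff₀ (by positivity) (by positivity)]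
  nlinarith [mul_le_mul_of_nonneg_left h1 (by positivity : 0 ≤ √(t : ℝ))]

/-- The floor on the projected allocations decreases with time, so `t` rounds guarantee `t` times
its last value. By `sqrt_le_mul_explore` this is of order `√t`. -/
lemma mul_explore_sub_le_pulls (hK : 0 < K) (hv : ∀ t, v t ω ∈ truncSimplex K (explore K t))
    (htrack : ∀ t, IsMinOn
      (fun k => (pulls arm t ω k : ℝ) - ∑ s ∈ Finset.range (t + 1), v s ω k) univ (arm t ω))
    (t : ℕ) (k : Fin K) :
    t * explore K t - K ≤ (pulls arm t ω k : ℝ) := by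
  refine le_trans ?_ (sum_alloc_sub_le_pulls (fun t => (hv t).1) htrack t k)
  have : ∑ s ∈ Finset.range t, explore K t ≤ ∑ s ∈ Finset.range t, v s ω k :=
    Finset.sum_le_sum fun s hs =>
      (explore_antitone K hK (Finset.mem_range.1 hs).le).trans ((hv s).2 k)
  simp only [Finset.sum_const, Finset.card_range, nsmul_eq_mul] at this
  linarith

lemma norm_proj_sub_le {K : ℕ} {ε : ℝ} (hε : 0 ≤ ε) (hKε : K * ε ≤ 1) {w v : Fin K → ℝ}
    (hw : w ∈ stdSimplex ℝ (Fin K)) (hv : IsMinOn (fun u => ‖u - w‖) (truncSimplex K ε) v) :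
    ‖v - w‖ ≤ K * ε := by
  have hw1 : ∀ k, w k ≤ 1 := fun k =>
    hw.2 ▸ Finset.single_le_sum (fun j _ => hw.1 j) (Finset.mem_univ k)
  -- The mixture of `w` with the uniform allocation is feasible and moves each weight by at most `K
  -- * ε`; the projection does no worse.
  have hmem : (fun k => (1 - K * ε) * w k + ε) ∈ truncSimplex K ε := by
    have h0 : ∀ k, 0 ≤ (1 - K * ε) * w k := fun k => mul_nonneg (by linarith) (hw.1 k)
    refine ⟨⟨fun k => by linarith [h0 k], ?_⟩, fun k => by linarith [h0 k]⟩
    rw [Finset.sum_add_distrib, ← Finset.mul_sum, hw.2]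
    simp
  refine (hv hmem).trans ((pi_norm_le_iff_of_nonneg (by positivity)).2 fun k => ?_)
  have hK1 : (1 : ℝ) ≤ K := by
    have : 0 < K := k.pos
    exact_mod_cast this
  rw [Real.norm_eq_abs, abs_le]
  simp only [Pi.sub_apply]
  have h1 : 0 ≤ K * ε := by positivity
  constructor
  · nlinarith [mul_le_mul_of_nonneg_left (hw1 k) h1]
  · nlinarith [mul_nonneg h1 (hw.1 k)]

end Tracking

/-! ### The threshold -/

section Threshold

lemma hInv_spec {y : ℝ} (hy : 1 ≤ y) : 1 ≤ hInv y ∧ hInv y - Real.log (hInv y) = y := by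
  have hex : ∃ u ∈ Ici (1 : ℝ), hFun u = y := by
    have hcont : ContinuousOn hFun (Icc 1 (2 * y)) := by
      refine continuousOn_id.sub (Real.continuousOn_log.mono fun x hx => ?_)
      have : (0 : ℝ) < x := by linarith [hx.1]
      simpa using this.ne'
    have h2 : y ≤ hFun (2 * y) := by
      have := Real.log_le_sub_one_of_pos (by linarith : 0 < y)
      rw [hFun, Real.log_mul (by norm_num) (by linarith)]
      have := Real.log_le_sub_one_of_pos (by norm_num : (0 : ℝ) < 2)
      linarith
    obtain ⟨u, hu, hu'⟩ := intermediate_value_Icc (by linarith) hcont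
      (⟨by simpa [hFun] using hy, h2⟩ : y ∈ Icc (hFun 1) (hFun (2 * y)))
    exact ⟨u, hu.1, hu'⟩
  exact ⟨Function.invFunOn_mem hex, Function.invFunOn_eq hex⟩

lemma le_hInv {y : ℝ} (hy : 1 ≤ y) : y ≤ hInv y := by
  obtain ⟨h1, h2⟩ := hInv_spec hy
  linarith [Real.log_nonneg h1]

/-- The crude bound `hInv y ≤ 2 * y`, from `log u ≤ u / 2`, is fed back into `hInv y = y + log (hInv
y)`. -/
lemma hInv_le {y : ℝ} (hy : 1 ≤ y) : hInv y ≤ y + Real.log (2 * y) := by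
  obtain ⟨h1, h2⟩ := hInv_spec hy
  have h3 : Real.log (hInv y) ≤ hInv y / 2 := by
    have e : Real.log (hInv y) = Real.log 2 + Real.log (hInv y / 2) := by
      rw [← Real.log_mul (by norm_num) (by linarith)]; congr 1; ring
    have := Real.log_le_sub_one_of_pos (by linarith : 0 < hInv y / 2)
    have := Real.log_le_sub_one_of_pos (by norm_num : (0 : ℝ) < 2)
    linarith
  have := Real.log_le_log (by linarith) (by linarith : hInv y ≤ 2 * y)
  linarith

lemma tendsto_hInv_atTop : Tendsto hInv atTop atTop :=
  tendsto_atTop_mono' _ ((eventually_ge_atTop 1).mono fun _ hy => le_hInv hy) tendsto_id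

lemma tendsto_log_div_atTop : Tendsto (fun x : ℝ => Real.log x / x) atTop (𝓝 0) :=
  Real.isLittleO_log_id_atTop.tendsto_div_nhds_zero

lemma tendsto_hInv_div : Tendsto (fun y => hInv y / y) atTop (𝓝 1) := by
  have hu : Tendsto (fun y : ℝ => 1 + 2 * (Real.log (2 * y) / (2 * y))) atTop (𝓝 1) := by
    have := (tendsto_log_div_atTop.comp (tendsto_id.const_mul_atTop (two_pos (α := ℝ)))).const_mul 2
    simpa using this.const_add 1
  refine tendsto_of_tendsto_of_tendsto_of_le_of_le' tendsto_const_nhds hu ?_ ?_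
  · filter_upwards [eventually_ge_atTop (1 : ℝ)] with y hy
    rw [le_div_iff₀ (by linarith), one_mul]
    exact le_hInv hy
  · filter_upwards [eventually_ge_atTop (1 : ℝ)] with y hy
    rw [div_le_iff₀ (by linarith)]
    refine (hInv_le hy).trans_eq ?_
    have : y ≠ 0 := by linarith
    field_simp

/-- The argument of `hTilde` is asymptotic to `x / 2`, the first branch applies eventually and is
asymptotic to its argument, and the prefactor `2` restores `x`. -/
lemma tendsto_calT_div : Tendsto (fun x => calT x / x) atTop (𝓝 1) := by
  set c := Real.log (2 * ∑' n : ℕ, 1 / ((n : ℝ) + 1) ^ 2) with hc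
  set y : ℝ → ℝ := fun x => (hInv (1 + x) + c) / 2 with hy
  have h1x : Tendsto (fun x : ℝ => 1 + x) atTop atTop := tendsto_atTop_add_const_left _ _ tendsto_id
  have hyt : Tendsto y atTop atTop :=
    (tendsto_atTop_add_const_right _ c (tendsto_hInv_atTop.comp h1x)).atTop_div_const two_pos
  have hinv : Tendsto (fun x : ℝ => 1 / x) atTop (𝓝 0) :=
    tendsto_const_nhds.div_atTop tendsto_id
  have hyx : Tendsto (fun x => y x / x) atTop (𝓝 (1 / 2)) := by
    have h1 : Tendsto (fun x : ℝ => (hInv (1 + x) / (1 + x) * (1 / x + 1) + c * (1 / x)) / 2) atTop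
        (𝓝 ((1 * (0 + 1) + c * 0) / 2)) :=
      (((tendsto_hInv_div.comp h1x).mul (hinv.add_const 1)).add (hinv.const_mul c)).div_const 2
    rw [show ((1 : ℝ) * (0 + 1) + c * 0) / 2 = 1 / 2 by ring] at h1
    refine h1.congr' ?_
    filter_upwards [eventually_gt_atTop (0 : ℝ)] with x hx
    have : 1 + x ≠ 0 := by positivity
    simp only [hy]
    field_simp
  have hexp : Tendsto (fun x => Real.exp (1 / hInv (y x))) atTop (𝓝 1) := by
    have := (Real.continuous_exp.tendsto 0).comp (hinv.comp (tendsto_hInv_atTop.comp hyt))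
    rwa [Real.exp_zero] at this
  have hmain : Tendsto (fun x => 2 * (Real.exp (1 / hInv (y x)) * (hInv (y x) / y x) * (y x / x)))
      atTop (𝓝 (2 * (1 * 1 * (1 / 2)))) :=
    ((hexp.mul (tendsto_hInv_div.comp hyt)).mul hyx).const_mul 2
  rw [show (2 : ℝ) * (1 * 1 * (1 / 2)) = 1 by norm_num] at hmain
  refine hmain.congr' ?_
  filter_upwards [hyt.eventually_ge_atTop (hInv (1 / Real.log (3 / 2))),
    hyt.eventually_gt_atTop 0] with x hx hx0
  rw [calT, hTilde, ← hc, if_pos hx]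
  change 2 * (Real.exp (1 / hInv (y x)) * (hInv (y x) / y x) * (y x / x))
    = 2 * (Real.exp (1 / hInv (y x)) * hInv (y x)) / x
  generalize y x = u at hx0
  field_simp

lemma eventually_mul_calT_le {K : ℕ} (hK : 0 < K) {η : ℝ} (hη : 0 < η) :
    ∀ᶠ ℓ : ℝ in atTop, K * calT (ℓ / K) ≤ (1 + η) * ℓ := by
  have hK' : (0 : ℝ) < K := by exact_mod_cast hK
  have h := tendsto_calT_div.comp ((tendsto_id (α := ℝ)).atTop_div_const hK')
  filter_upwards [h.eventually_le_const (by linarith : (1 : ℝ) < 1 + η),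
    eventually_gt_atTop 0] with ℓ h1 h2
  have h3 : calT (ℓ / K) / (ℓ / K) ≤ 1 + η := h1
  rw [div_le_iff₀ (by positivity)] at h3
  calc K * calT (ℓ / K) ≤ K * ((1 + η) * (ℓ / K)) := by gcongr
    _ = (1 + η) * ℓ := by field_simp

lemma threshold_le {K : ℕ} {N : Fin K → ℕ} {t : ℕ} (h0 : ∀ k, 0 < N k) (ht : ∀ k, N k ≤ t)
    (δ : ℝ) :
    threshold N δ ≤ 3 * K * Real.log t + K * calT (Real.log (1 / δ) / K) := by
  have h : ∀ k, 3 * Real.log (1 + Real.log (N k)) ≤ 3 * Real.log t := by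
    intro k
    have h1 : (1 : ℝ) ≤ N k := by exact_mod_cast h0 k
    have h2 := Real.log_nonneg h1
    have h3 := Real.log_le_sub_one_of_pos (by linarith : 0 < 1 + Real.log (N k))
    have h4 : Real.log (N k) ≤ Real.log t :=
      Real.log_le_log (by linarith) (by exact_mod_cast ht k)
    linarith
  have := Finset.sum_le_sum fun k (_ : k ∈ Finset.univ) => h k
  rw [threshold]
  simp only [Finset.sum_const, Finset.card_univ, Fintype.card_fin, nsmul_eq_mul] at this
  linarith

end Threshold


/-! ### Concentration of the empirical means -/

section Concentration

variable {L K : ℕ} {Ω : Type*} [mΩ : MeasurableSpace Ω] {P : Vec L → Measure (Vec L)}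
  {M : Inst L K} {Pr : Measure Ω} [IsProbabilityMeasure Pr] {ℱ : Filtration ℕ mΩ}
  {arm : ℕ → Ω → Fin K} {R : ℕ → Ω → Vec L}

lemma measure_inter_reward (hR : ∀ t, Measurable[ℱ (t + 1)] (R t))
    (hP : ∀ k, IsProbabilityMeasure (P (M k)))
    (hlaw : ∀ t (B : Set (Vec L)), MeasurableSet B →
      Pr[(R t ⁻¹' B).indicator (fun _ => (1 : ℝ)) | ℱ t] =ᵐ[Pr] fun ω => (P (M (arm t ω))).real B)
    {t : ℕ} {k : Fin K} {A : Set Ω} (hA : MeasurableSet[ℱ t] A) (hAk : ∀ ω ∈ A, arm t ω = k)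
    {B : Set (Vec L)} (hB : MeasurableSet B) :
    Pr (R t ⁻¹' B ∩ A) = Pr A * P (M k) B := by
  have hA' : MeasurableSet A := ℱ.le t A hA
  have hRB : MeasurableSet (R t ⁻¹' B) := ((hR t).mono (ℱ.le _) le_rfl) hB
  have h1 := setIntegral_condExp (μ := Pr) (ℱ.le t)
    (f := (R t ⁻¹' B).indicator (fun _ => (1 : ℝ))) ((integrable_const _).indicator hRB) hA
  have h2 : ∫ ω in A, (Pr[(R t ⁻¹' B).indicator (fun _ => (1 : ℝ)) | ℱ t]) ω ∂Pr
      = Pr.real A * (P (M k)).real B := by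
    have : ∫ ω in A, (Pr[(R t ⁻¹' B).indicator (fun _ => (1 : ℝ)) | ℱ t]) ω ∂Pr
        = ∫ ω in A, (P (M k)).real B ∂Pr := by
      refine setIntegral_congr_ae hA' ?_
      filter_upwards [hlaw t B hB] with ω hω hωA
      rw [hω, hAk ω hωA]
    rw [this]
    simp
  rw [h2, integral_indicator hRB] at h1
  simp only [integral_const, smul_eq_mul, mul_one, measureReal_restrict_apply_univ] at h1
  rw [measureReal_restrict_apply hRB] at h1
  have h3 := congrArg ENNReal.ofReal h1
  rw [ENNReal.ofReal_mul measureReal_nonneg] at h3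
  rw [ofReal_measureReal, ofReal_measureReal, ofReal_measureReal] at h3
  exact h3.symm

/-- On the event that arm `k` is pulled, reweighting by `g (R t)` acts on `ℱ t` as multiplication by
the mean of `g`: the trimmed measures are proportional, hence integrate every `ℱ t`-measurable `W`
proportionally. -/
lemma lintegral_mul_reward (harm : ∀ t, Measurable[ℱ t] (arm t))
    (hR : ∀ t, Measurable[ℱ (t + 1)] (R t)) (hP : ∀ k, IsProbabilityMeasure (P (M k)))
    (hlaw : ∀ t (B : Set (Vec L)), MeasurableSet B →
      Pr[(R t ⁻¹' B).indicator (fun _ => (1 : ℝ)) | ℱ t] =ᵐ[Pr] fun ω => (P (M (arm t ω))).real B)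
    (t : ℕ) (k : Fin K) {W : Ω → ℝ≥0∞} (hW : Measurable[ℱ t] W) {g : Vec L → ℝ≥0∞}
    (hg : Measurable g) :
    ∫⁻ ω in {ω | arm t ω = k}, W ω * g (R t ω) ∂Pr
      = (∫⁻ ω in {ω | arm t ω = k}, W ω ∂Pr) * ∫⁻ x, g x ∂(P (M k)) := by
  set S := {ω | arm t ω = k} with hS
  have hSt : MeasurableSet[ℱ t] S := harm t (measurableSet_singleton k)
  have hS' : MeasurableSet S := ℱ.le t S hSt
  have hRm : Measurable (R t) := (hR t).mono (ℱ.le _) le_rfl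
  set κ := (Pr.restrict S).withDensity (fun ω => g (R t ω)) with hκ
  have htrim : κ.trim (ℱ.le t)
      = (∫⁻ x, g x ∂(P (M k))) • (Pr.restrict S).trim (ℱ.le t) := by
    refine @Measure.ext _ (ℱ t) _ _ fun A hA => ?_
    have hA' : MeasurableSet A := ℱ.le t A hA
    have hmap : (Pr.restrict (A ∩ S)).map (R t) = Pr (A ∩ S) • P (M k) := by
      ext B hB
      rw [Measure.map_apply hRm hB, Measure.restrict_apply (hRm hB),
        measure_inter_reward hR hP hlaw (@MeasurableSet.inter _ (ℱ t) _ _ hA hSt)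
          (fun ω hω => hω.2) hB]
      rfl
    have hlhs : κ A = Pr (A ∩ S) * ∫⁻ x, g x ∂(P (M k)) := by
      rw [hκ, withDensity_apply _ hA', Measure.restrict_restrict hA', ← lintegral_map hg hRm, hmap,
        lintegral_smul_measure, smul_eq_mul]
    rw [Measure.smul_apply, trim_measurableSet_eq _ hA, trim_measurableSet_eq _ hA, hlhs,
      Measure.restrict_apply hA', smul_eq_mul, mul_comm]
  have h1 : ∫⁻ ω in S, W ω * g (R t ω) ∂Pr = ∫⁻ ω, W ω ∂κ := by
    rw [hκ, lintegral_withDensity_eq_lintegral_mul _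
      (show Measurable fun ω => g (R t ω) from hg.comp hRm) (hW.mono (ℱ.le t) le_rfl)]
    simp only [Pi.mul_apply, mul_comm]
  rw [h1, ← lintegral_trim (ℱ.le t) hW, htrim, lintegral_smul_measure, lintegral_trim (ℱ.le t) hW,
    smul_eq_mul, mul_comm]

/-- The product of the values of `g` at the rewards of arm `k`. -/
noncomputable def rewardProd (arm : ℕ → Ω → Fin K) (R : ℕ → Ω → Vec L) (k : Fin K)
    (g : Vec L → ℝ≥0∞) (t : ℕ) (ω : Ω) : ℝ≥0∞ :=
  ∏ i ∈ (Finset.range t).filter (fun i => arm i ω = k), g (R i ω)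

omit mΩ in
lemma rewardProd_succ (arm : ℕ → Ω → Fin K) (R : ℕ → Ω → Vec L) (k : Fin K) (g : Vec L → ℝ≥0∞)
    (t : ℕ) (ω : Ω) :
    rewardProd arm R k g (t + 1) ω
      = rewardProd arm R k g t ω * if arm t ω = k then g (R t ω) else 1 := by
  simp only [rewardProd, Finset.prod_filter, Finset.prod_range_succ]

lemma measurable_rewardProd (harm : ∀ t, Measurable[ℱ t] (arm t))
    (hR : ∀ t, Measurable[ℱ (t + 1)] (R t)) (k : Fin K) {g : Vec L → ℝ≥0∞} (hg : Measurable g)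
    (t : ℕ) : Measurable[ℱ t] (rewardProd arm R k g t) := by
  induction t with
  | zero =>
    have : rewardProd arm R k g 0 = fun _ => 1 := by
      ext ω; simp [rewardProd]
    rw [this]
    exact measurable_const
  | succ t ih =>
    have : rewardProd arm R k g (t + 1) = fun ω => rewardProd arm R k g t ω *
        if arm t ω = k then g (R t ω) else 1 := funext fun ω => rewardProd_succ arm R k g t ω
    rw [this]
    have hle := ℱ.mono (Nat.le_succ t)
    refine Measurable.mul (ih.mono hle le_rfl) (Measurable.ite ?_ (hg.comp (hR t)) measurable_const)
    exact hle _ (harm t (measurableSet_singleton k))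

/-- One step of a supermartingale: a pull of `k` multiplies the mean by at most one, any other pull
changes nothing. -/
lemma lintegral_rewardProd_le (harm : ∀ t, Measurable[ℱ t] (arm t))
    (hR : ∀ t, Measurable[ℱ (t + 1)] (R t)) (hP : ∀ k, IsProbabilityMeasure (P (M k)))
    (hlaw : ∀ t (B : Set (Vec L)), MeasurableSet B →
      Pr[(R t ⁻¹' B).indicator (fun _ => (1 : ℝ)) | ℱ t] =ᵐ[Pr] fun ω => (P (M (arm t ω))).real B)
    (k : Fin K) {g : Vec L → ℝ≥0∞} (hg : Measurable g) (hg1 : ∫⁻ x, g x ∂(P (M k)) ≤ 1) (t : ℕ) :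
    ∫⁻ ω, rewardProd arm R k g t ω ∂Pr ≤ 1 := by
  induction t with
  | zero => simp [rewardProd]
  | succ t ih =>
    refine le_trans ?_ ih
    simp_rw [rewardProd_succ]
    set S := {ω | arm t ω = k} with hS
    have hS' : MeasurableSet S := ℱ.le t S (harm t (measurableSet_singleton k))
    rw [← lintegral_add_compl _ hS', ← lintegral_add_compl (rewardProd arm R k g t) hS']
    refine add_le_add ?_ ?_
    · have e : ∫⁻ ω in S, (rewardProd arm R k g t ω * if arm t ω = k then g (R t ω) else 1) ∂Pr
          = ∫⁻ ω in S, rewardProd arm R k g t ω * g (R t ω) ∂Pr :=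
        setLIntegral_congr_fun hS' fun ω hω => by
          have : arm t ω = k := hω
          simp [this]
      rw [e, lintegral_mul_reward harm hR hP hlaw t k (measurable_rewardProd harm hR k hg t) hg]
      exact mul_le_of_le_one_right' hg1
    · refine (setLIntegral_congr_fun hS'.compl fun ω hω => ?_).le
      have : arm t ω ≠ k := hω
      simp [this]

/-- The exponential weight in direction `u`. -/
noncomputable def expTilt (m u : Vec L) (c : ℝ) (x : Vec L) : ℝ≥0∞ :=
  ENNReal.ofReal (Real.exp (⟪u, x - m⟫ - c))

lemma measurable_expTilt (m u : Vec L) (c : ℝ) : Measurable (expTilt m u c) := by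
  unfold expTilt
  fun_prop

lemma lintegral_expTilt_le {ν : Measure (Vec L)} {m : Vec L} {σ : ℝ≥0}
    (h : IsSubGaussianVec ν m σ) (u : Vec L) :
    ∫⁻ x, expTilt m u ((σ : ℝ) ^ 2 * ‖u‖ ^ 2 / 2) x ∂ν ≤ 1 := by
  have hi := (h u).integrable_exp_mul 1
  have hm := (h u).mgf_le 1
  simp only [one_mul, mgf] at hi hm
  unfold expTilt
  rw [← ofReal_integral_eq_lintegral_ofReal _ (ae_of_all _ fun x => (Real.exp_pos _).le)]
  · simp_rw [Real.exp_sub, integral_div]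
    rw [ENNReal.ofReal_le_one, div_le_one (Real.exp_pos _)]
    refine hm.trans_eq ?_
    congr 1
    push_cast
    ring
  · simp_rw [Real.exp_sub]
    exact hi.div_const _

omit mΩ in
lemma rewardProd_expTilt (m u : Vec L) (c : ℝ) (k : Fin K) (t : ℕ) (ω : Ω)
    (h0 : 0 < pulls arm t ω k) :
    rewardProd arm R k (expTilt m u c) t ω
      = ENNReal.ofReal (Real.exp (pulls arm t ω k * (⟪u, empMean arm R t ω k - m⟫ - c))) := by
  have hN : (pulls arm t ω k : ℝ) ≠ 0 := by exact_mod_cast h0.ne'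
  simp only [rewardProd, expTilt]
  rw [← ENNReal.ofReal_prod_of_nonneg (fun i _ => (Real.exp_pos _).le), ← Real.exp_sum]
  congr 2
  rw [Finset.sum_sub_distrib, ← inner_sum, Finset.sum_sub_distrib, Finset.sum_const,
    Finset.sum_const, ← pulls]
  have e : ∑ s ∈ (Finset.range t).filter (fun s => arm s ω = k), R s ω
      = (pulls arm t ω k : ℝ) • empMean arm R t ω k := by
    rw [empMean, smul_inv_smul₀ hN]
  rw [e, ← Nat.cast_smul_eq_nsmul ℝ, ← smul_sub, real_inner_smul_right, nsmul_eq_mul]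
  ring

lemma exists_lt_abs_of_lt_norm {x : Vec L} {ξ : ℝ} (hξ : 0 < ξ) (h : ξ < ‖x‖) :
    ∃ l, ξ / (L + 1) < |x l| := by
  by_contra! hcon
  have h1 : ‖x‖ ≤ ∑ l, |x l| := by
    conv_lhs => rw [← (EuclideanSpace.basisFun (Fin L) ℝ).sum_repr x]
    refine (norm_sum_le _ _).trans (Finset.sum_le_sum fun l _ => ?_)
    rw [norm_smul, (EuclideanSpace.basisFun (Fin L) ℝ).norm_eq_one, mul_one, Real.norm_eq_abs]
    simp
  have h2 := Finset.sum_le_sum fun l (_ : l ∈ Finset.univ) => hcon l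
  simp only [Finset.sum_const, Finset.card_univ, Fintype.card_fin, nsmul_eq_mul] at h2
  have h3 : (L : ℝ) * (ξ / (L + 1)) ≤ ξ := by
    rw [← mul_div_assoc, div_le_iff₀ (by positivity)]
    nlinarith
  linarith

/-- Some empirical mean is not within `ξ` of the mean. -/
def deviates (M : Inst L K) (ξ : ℝ) (arm : ℕ → Ω → Fin K) (R : ℕ → Ω → Vec L) (t : ℕ) : Set Ω :=
  {ω | ∃ k, 0 < pulls arm t ω k ∧ ξ < ‖empMean arm R t ω k - M k‖}

/-- The directions in which deviations are controlled. -/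
noncomputable def testDir (s : ℝ) (l : Fin L) (b : Bool) : Vec L :=
  (if b then s else -s) • EuclideanSpace.single l 1

lemma norm_testDir (s : ℝ) (l : Fin L) (b : Bool) : ‖testDir s l b‖ = |s| := by
  cases b <;> simp [testDir, norm_smul]

omit mΩ in
-- Chernoff's argument as a pointwise domination: a deviation makes the exponential weight of one
-- arm, coordinate and sign large. The `+ 1` terms keep denominators positive when `L` or `σ` is
-- zero.
lemma one_le_sum_rewardProd {ξ : ℝ} (hξ : 0 < ξ) (σ : ℝ≥0) {t : ℕ} {ω : Ω} {n : ℝ}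
    (hn : ∀ k, n ≤ pulls arm t ω k) (h : ω ∈ deviates M ξ arm R t) :
    1 ≤ ENNReal.ofReal (Real.exp (-((ξ / (L + 1)) ^ 2 / (2 * (σ ^ 2 + 1)) * n))) *
      ∑ q : Fin K × Fin L × Bool, rewardProd arm R q.1
        (expTilt (M q.1) (testDir (ξ / (L + 1) / (σ ^ 2 + 1)) q.2.1 q.2.2)
          ((σ : ℝ) ^ 2 * ‖testDir (ξ / (L + 1) / (σ ^ 2 + 1)) q.2.1 q.2.2‖ ^ 2 / 2)) t ω := by
  obtain ⟨k, hk, hdev⟩ := h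
  obtain ⟨l, hl⟩ := exists_lt_abs_of_lt_norm hξ hdev
  set ζ := ξ / ((L : ℝ) + 1) with hζ
  have hζ0 : 0 < ζ := by positivity
  set s := ζ / ((σ : ℝ) ^ 2 + 1) with hs
  have hs0 : 0 < s := by positivity
  set x := empMean arm R t ω k - M k with hx
  obtain ⟨b, hb⟩ : ∃ b, s * ζ ≤ ⟪testDir s l b, x⟫ := by
    have hin : ∀ b, ⟪testDir s l b, x⟫ = (if b then s else -s) * x l := by
      intro b
      rw [testDir, real_inner_smul_left, EuclideanSpace.inner_single_left]
      simp
    rcases le_total 0 (x l) with h0 | h0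
    · refine ⟨true, ?_⟩
      rw [abs_of_nonneg h0] at hl
      simp only [hin, if_true]
      gcongr
    · refine ⟨false, ?_⟩
      rw [abs_of_nonpos h0] at hl
      rw [hin, if_neg Bool.false_ne_true]
      nlinarith
  have hexp : ζ ^ 2 / (2 * ((σ : ℝ) ^ 2 + 1)) * n
      ≤ pulls arm t ω k * (⟪testDir s l b, x⟫ - (σ : ℝ) ^ 2 * ‖testDir s l b‖ ^ 2 / 2) := by
    rw [norm_testDir, sq_abs]
    -- The tilt `s` optimises the exponent for the variance proxy `σ ^ 2 + 1`; the true proxy `σ ^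
    -- 2` leaves the surplus `s ^ 2 / 2`.
    have h1 : ζ ^ 2 / (2 * ((σ : ℝ) ^ 2 + 1)) ≤ s * ζ - (σ : ℝ) ^ 2 * s ^ 2 / 2 := by
      have : s * ζ - (σ : ℝ) ^ 2 * s ^ 2 / 2 - ζ ^ 2 / (2 * ((σ : ℝ) ^ 2 + 1)) = s ^ 2 / 2 := by
        rw [hs]; field_simp; ring
      nlinarith [sq_nonneg s]
    have h2 : (0 : ℝ) ≤ ζ ^ 2 / (2 * ((σ : ℝ) ^ 2 + 1)) := by positivity
    calc _ ≤ ζ ^ 2 / (2 * ((σ : ℝ) ^ 2 + 1)) * pulls arm t ω k := by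
          gcongr
          exact hn k
      _ ≤ (⟪testDir s l b, x⟫ - (σ : ℝ) ^ 2 * s ^ 2 / 2) * pulls arm t ω k := by
          gcongr
          linarith
      _ = _ := mul_comm _ _
  have hterm := Finset.single_le_sum (f := fun q : Fin K × Fin L × Bool => rewardProd arm R q.1
        (expTilt (M q.1) (testDir s q.2.1 q.2.2)
          ((σ : ℝ) ^ 2 * ‖testDir s q.2.1 q.2.2‖ ^ 2 / 2)) t ω)
    (fun _ _ => bot_le) (Finset.mem_univ (k, l, b))
  refine le_trans ?_ (mul_le_mul_right hterm _)
  rw [rewardProd_expTilt _ _ _ _ _ _ hk, ← ENNReal.ofReal_mul (Real.exp_pos _).le, ← Real.exp_add]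
  exact ENNReal.one_le_ofReal.2 (Real.one_le_exp (by linarith))

lemma summable_exploration_tail {K : ℕ} (hK : 0 < K) {c : ℝ} (hc : 0 < c) :
    Summable fun t : ℕ => ((t : ℝ) + 1) * Real.exp (-(c * (t * explore K t - K))) := by
  set b := c / (2 * ((K : ℝ) + 1)) with hb
  have hb0 : 0 < b := by positivity
  have hs : Summable fun t : ℕ => (Real.exp (c * K) * 1440 / b ^ 6) * (1 / (t : ℝ) ^ 2) :=
    (Real.summable_one_div_nat_pow.2 one_lt_two).mul_left _
  refine Summable.of_norm_bounded_eventually_nat hs ?_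
  filter_upwards [eventually_ge_atTop 1] with t ht
  have ht' : (1 : ℝ) ≤ t := by exact_mod_cast ht
  have ht0 : (0 : ℝ) < t := by linarith
  rw [Real.norm_of_nonneg (by positivity)]
  have h1 : Real.exp (-(c * (t * explore K t - K)))
      ≤ Real.exp (c * K) * Real.exp (-(b * √t)) := by
    rw [← Real.exp_add]
    refine Real.exp_le_exp.2 ?_
    have := mul_le_mul_of_nonneg_left (sqrt_le_mul_explore K hK t) hc.le
    have e : c * (√(t : ℝ) / (2 * (K + 1))) = b * √t := by rw [hb]; ring
    linarith
  -- The sixth-order term of the exponential series gives decay `t ^ (-3)`, enough to absorb the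
  -- weight `t + 1`.
  have h2 : Real.exp (-(b * √t)) ≤ 720 / (b ^ 6 * t ^ 3) := by
    have h := Real.pow_div_factorial_le_exp (b * √(t : ℝ)) (by positivity) 6
    have e : (b * √(t : ℝ)) ^ 6 = b ^ 6 * (t : ℝ) ^ 3 := by
      rw [mul_pow, show √(t : ℝ) ^ 6 = (√(t : ℝ) ^ 2) ^ 3 by ring, Real.sq_sqrt ht0.le]
    rw [e] at h
    rw [Real.exp_neg, inv_le_comm₀ (Real.exp_pos _) (by positivity), inv_div]
    simpa [Nat.factorial] using h
  calc _ ≤ (t + t) * (Real.exp (c * K) * (720 / (b ^ 6 * t ^ 3))) := by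
        gcongr
        exact h1.trans (by gcongr)
    _ = _ := by
        field_simp
        norm_num

end Concentration

/-- The expected number of rounds with a deviation, weighted by the round, is bounded by a constant
that does not depend on the run. -/
lemma exists_lintegral_deviates_le {L K : ℕ} (hK : 0 < K) (σ : ℝ≥0) {ξ : ℝ} (hξ : 0 < ξ) :
    ∃ c : ℝ≥0, ∀ {Ω : Type*} [mΩ : MeasurableSpace Ω] (P : Vec L → Measure (Vec L))
      (M : Inst L K) (Pr : Measure Ω) [IsProbabilityMeasure Pr] (ℱ : Filtration ℕ mΩ)
      (arm : ℕ → Ω → Fin K) (R : ℕ → Ω → Vec L),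
      (∀ k, IsProbabilityMeasure (P (M k))) → (∀ k, IsSubGaussianVec (P (M k)) (M k) σ) →
      (∀ t, Measurable[ℱ t] (arm t)) → (∀ t, Measurable[ℱ (t + 1)] (R t)) →
      (∀ t (B : Set (Vec L)), MeasurableSet B →
        Pr[(R t ⁻¹' B).indicator (fun _ => (1 : ℝ)) | ℱ t]
          =ᵐ[Pr] fun ω => (P (M (arm t ω))).real B) →
      (∀ t ω k, t * explore K t - K ≤ (pulls arm t ω k : ℝ)) →
      ∫⁻ ω, ∑' t : ℕ, ((t : ℝ≥0∞) + 1) * (deviates M ξ arm R t).indicator 1 ω ∂Pr ≤ c := by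
  set κ := (ξ / ((L : ℝ) + 1)) ^ 2 / (2 * ((σ : ℝ) ^ 2 + 1)) with hκ
  have hκ0 : 0 < κ := by positivity
  have hsum := summable_exploration_tail hK hκ0
  set f : ℕ → ℝ := fun t => ((t : ℝ) + 1) * Real.exp (-(κ * (t * explore K t - K))) with hf
  have hf0 : ∀ t, 0 ≤ f t := fun t => by positivity
  have hfe : ∀ t : ℕ, ((t : ℝ≥0∞) + 1) * ENNReal.ofReal (Real.exp (-(κ * (t * explore K t - K))))
      = ENNReal.ofReal (f t) := by
    intro t
    rw [hf, ENNReal.ofReal_mul (by positivity), ENNReal.ofReal_add (by positivity) one_pos.le]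
    simp
  have hfin : (∑' t, ENNReal.ofReal (f t)) * (Fintype.card (Fin K × Fin L × Bool) : ℝ≥0∞) ≠ ⊤ := by
    refine ENNReal.mul_ne_top ?_ (ENNReal.natCast_ne_top _)
    rw [← ENNReal.ofReal_tsum_of_nonneg hf0 hsum]
    exact ENNReal.ofReal_ne_top
  refine ⟨_, fun {Ω} _ P M Pr _ ℱ arm R hP hσ harm hR hlaw hpulls =>
    le_trans ?_ (ENNReal.coe_toNNReal hfin).ge⟩
  set W : Fin K × Fin L × Bool → ℕ → Ω → ℝ≥0∞ := fun q => rewardProd arm R q.1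
        (expTilt (M q.1) (testDir (ξ / (L + 1) / (σ ^ 2 + 1)) q.2.1 q.2.2)
          ((σ : ℝ) ^ 2 * ‖testDir (ξ / (L + 1) / (σ ^ 2 + 1)) q.2.1 q.2.2‖ ^ 2 / 2)) with hW
  have hWm : ∀ q t, Measurable (W q t) := fun q t =>
    (measurable_rewardProd harm hR q.1 (measurable_expTilt _ _ _) t).mono (ℱ.le t) le_rfl
  have hW1 : ∀ q t, ∫⁻ ω, W q t ω ∂Pr ≤ 1 := fun q t =>
    lintegral_rewardProd_le harm hR hP hlaw q.1 (measurable_expTilt _ _ _)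
      (lintegral_expTilt_le (hσ q.1) _) t
  calc ∫⁻ ω, ∑' t : ℕ, ((t : ℝ≥0∞) + 1) * (deviates M ξ arm R t).indicator 1 ω ∂Pr
      ≤ ∫⁻ ω, ∑' t : ℕ, ENNReal.ofReal (f t) * ∑ q, W q t ω ∂Pr := by
        refine lintegral_mono fun ω => ENNReal.tsum_le_tsum fun t => ?_
        by_cases hω : ω ∈ deviates M ξ arm R t
        · rw [indicator_of_mem hω, ← hfe, mul_assoc]
          exact mul_le_mul_right (one_le_sum_rewardProd hξ σ (hpulls t ω) hω) _
        · simp [indicator_of_notMem hω]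
    _ = ∑' t : ℕ, ENNReal.ofReal (f t) * ∑ q, ∫⁻ ω, W q t ω ∂Pr := by
        rw [lintegral_tsum fun t => by fun_prop]
        congr 1
        ext t
        rw [lintegral_const_mul _ (by fun_prop), lintegral_finsetSum _ fun q _ => hWm q t]
    _ ≤ ∑' t : ℕ, ENNReal.ofReal (f t) * (Fintype.card (Fin K × Fin L × Bool) : ℝ≥0∞) := by
        refine ENNReal.tsum_le_tsum fun t => mul_le_mul_right ?_ _
        refine (Finset.sum_le_sum fun q _ => hW1 q t).trans_eq ?_
        simp
    _ = _ := ENNReal.tsum_mul_right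


/-! ### The sample complexity -/

section Local

variable {L K : ℕ}

/-- The relaxed objective with a fixed set `A` of alternatives. -/
noncomputable def fixedInf (C : Set (Vec L)) (P : Vec L → Measure (Vec L)) (A : Set (Inst L K))
    (a : Fin K → ℝ≥0∞) (M : Inst L K) : ℝ≥0∞ :=
  ⨅ N ∈ A, ⨅ z ∈ C \ {0}, ∑ k, a k * projKL P z (M k) (N k)

lemma fixedInf_le {C : Set (Vec L)} {P : Vec L → Measure (Vec L)} {A : Set (Inst L K)}
    {a : Fin K → ℝ≥0∞} {M N : Inst L K} {z : Vec L} (hN : N ∈ A) (hz : z ∈ C \ {0}) :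
    fixedInf C P A a M ≤ ∑ k, a k * projKL P z (M k) (N k) :=
  (iInf₂_le N hN).trans (iInf₂_le z hz)

/-- `A` is the relaxed alternating set of all instances within `ξ` of `M`, and on this
neighbourhood the projected divergences to the box vary by at most `ε` and are bounded by `B`. -/
structure LocalModel (C : Set (Vec L)) (Mmin Mmax : ℝ) (D : Set (Vec L))
    (P : Vec L → Measure (Vec L)) (M : Inst L K) (A : Set (Inst L K)) (ξ B ε : ℝ) : Prop where
  subset : A ⊆ instSet L K Mmin Mmax
  bound_nonneg : 0 ≤ B
  mem_domain : ∀ M' : Inst L K, (∀ k, ‖M' k - M k‖ ≤ ξ) → ∀ k, M' k ∈ D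
  pareto_nonempty : ∀ M' : Inst L K, (∀ k, ‖M' k - M k‖ ≤ ξ) → (paretoPolicies C M').Nonempty
  hull_eq : ∀ M' : Inst L K, (∀ k, ‖M' k - M k‖ ≤ ξ) → ∀ p ∈ paretoPolicies C M',
    (closedConvexHull ℝ (altBoundary C Mmin Mmax p) : Set (Inst L K)) = A
  projKL_le : ∀ M' : Inst L K, (∀ k, ‖M' k - M k‖ ≤ ξ) → ∀ N ∈ A, ∀ k z,
    projKL P z (M' k) (N k) ≤ ENNReal.ofReal B
  projKL_le_add : ∀ M' M'' : Inst L K, (∀ k, ‖M' k - M k‖ ≤ ξ) → (∀ k, ‖M'' k - M k‖ ≤ ξ) →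
    ∀ N ∈ A, ∀ k z, projKL P z (M' k) (N k) ≤ projKL P z (M'' k) (N k) + ENNReal.ofReal ε

lemma isCompact_box (L : ℕ) (a b : ℝ) : IsCompact {x : Vec L | ∀ l, x l ∈ Icc a b} := by
  have h : IsCompact (Set.pi univ fun _ : Fin L => Icc a b) :=
    isCompact_univ_pi fun _ => isCompact_Icc
  convert h.image (EuclideanSpace.equiv (Fin L) ℝ).symm.continuous
  ext x
  constructor
  · intro hx
    exact ⟨x.ofLp, fun l _ => hx l, rfl⟩
  · rintro ⟨y, hy, rfl⟩ l
    exact hy l (mem_univ l)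

lemma exists_pos_forall_le (r : Fin K → ℝ) (hr : ∀ k, 0 < r k) : ∃ ξ > 0, ∀ k, ξ ≤ r k := by
  have h : ∀ᶠ ξ : ℝ in 𝓝[>] 0, ∀ k, ξ ≤ r k :=
    eventually_all.2 fun k => by
      filter_upwards [Ioo_mem_nhdsGT (hr k)] with ξ hξ using hξ.2.le
  obtain ⟨ξ, h1, h2⟩ := (h.and self_mem_nhdsWithin).exists
  exact ⟨ξ, h2, h1⟩

lemma exists_localModel (hK : 0 < K) {C : Set (Vec L)} (hC : IsPreferenceCone C) {Mmin Mmax : ℝ}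
    {D : Set (Vec L)} {P : Vec L → Measure (Vec L)} (hP : IsMeanExpFamily D P)
    (hD : ∀ x : Vec L, (∀ l, x l ∈ Icc Mmin Mmax) → x ∈ D) {M : Inst L K}
    (hM : M ∈ instSet L K Mmin Mmax) {w : Fin K → ℝ} (hw : relaxedValue C Mmin Mmax P w M ≠ 0)
    {ε : ℝ} (hε : 0 < ε) :
    ∃ A ξ B, 0 < ξ ∧ LocalModel C Mmin Mmax D P M A ξ B ε := by
  have hprob : ∀ k, IsProbabilityMeasure (P (M k)) := by
    obtain ⟨-, d, h, T, η, ψ, -, -, -, -, hfam⟩ := hP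
    exact fun k => (hfam (M k) (hD _ (hM k))).2.2.1
  obtain ⟨A, hA, ξ₀, hξ₀, hloc⟩ := exists_locally_constant_alternatives hK hC hM hprob hw
  have hnb : ∀ k, ∃ r > 0, ∃ B : ℝ, ∀ m ∈ Metric.closedBall (M k) r,
      m ∈ D ∧ ∀ n ∈ {x : Vec L | ∀ l, x l ∈ Icc Mmin Mmax}, ∀ z : Vec L,
      projKL P z m n ≤ ENNReal.ofReal B ∧
      ∀ m' ∈ Metric.closedBall (M k) r, projKL P z m n ≤ projKL P z m' n + ENNReal.ofReal ε := by
    intro k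
    obtain ⟨U, hU, B, h⟩ := hP.exists_nhds_projKL (isCompact_box L Mmin Mmax) (fun x hx => hD x hx)
      (hD _ (hM k)) hε
    obtain ⟨r, hr, hrU⟩ := Metric.nhds_basis_closedBall.mem_iff.1 hU
    exact ⟨r, hr, B, fun m hm => ⟨(h m (hrU hm)).1, fun n hn z => ⟨((h m (hrU hm)).2 n hn z).1,
      fun m' hm' => ((h m (hrU hm)).2 n hn z).2 m' (hrU hm')⟩⟩⟩
  choose r hr B hB using hnb
  obtain ⟨ξ₁, hξ₁, hξr⟩ := exists_pos_forall_le r hr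
  have hball : ∀ M' : Inst L K, (∀ k, ‖M' k - M k‖ ≤ min ξ₀ ξ₁) →
      ∀ k, M' k ∈ Metric.closedBall (M k) (r k) := fun M' h k =>
    mem_closedBall_iff_norm.2 ((h k).trans ((min_le_right _ _).trans (hξr k)))
  have hBle : ∀ k, B k ≤ ∑ j, |B j| := fun k => (le_abs_self _).trans
    (Finset.single_le_sum (f := fun j => |B j|) (fun j _ => abs_nonneg _) (Finset.mem_univ k))
  refine ⟨A, min ξ₀ ξ₁, ∑ j, |B j|, lt_min hξ₀ hξ₁, hA,
    Finset.sum_nonneg fun j _ => abs_nonneg _,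
    fun M' h k => (hB k _ (hball M' h k)).1,
    fun M' h => (hloc M' fun k => (h k).trans (min_le_left _ _)).1,
    fun M' h => (hloc M' fun k => (h k).trans (min_le_left _ _)).2,
    fun M' h N hN k z => (((hB k _ (hball M' h k)).2 _ (hA hN k) z).1).trans
      (ENNReal.ofReal_le_ofReal (hBle k)),
    fun M' M'' h h' N hN k z => ((hB k _ (hball M' h k)).2 _ (hA hN k) z).2 _ (hball M'' h' k)⟩

variable {C : Set (Vec L)} {Mmin Mmax : ℝ} {D : Set (Vec L)} {P : Vec L → Measure (Vec L)}
  {M : Inst L K} {A : Set (Inst L K)} {ξ B ε : ℝ}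

namespace LocalModel

lemma relaxedInf_eq (h : LocalModel C Mmin Mmax D P M A ξ B ε) {M' : Inst L K}
    (hM' : ∀ k, ‖M' k - M k‖ ≤ ξ) {p : Fin K → ℝ} (hp : p ∈ paretoPolicies C M')
    (a : Fin K → ℝ≥0∞) : relaxedInf C Mmin Mmax P a M' p = fixedInf C P A a M' := by
  have e := h.hull_eq M' hM' p hp
  rw [relaxedInf, fixedInf]
  simp only [← e]

/-- All Pareto policies of a nearby instance give the same inner infimum, so the infimum over them
is that common value. -/
lemma relaxedValue_eq (h : LocalModel C Mmin Mmax D P M A ξ B ε) {M' : Inst L K}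
    (hM' : ∀ k, ‖M' k - M k‖ ≤ ξ) (u : Fin K → ℝ) :
    relaxedValue C Mmin Mmax P u M' = fixedInf C P A (fun k => ENNReal.ofReal (u k)) M' := by
  obtain ⟨p, hp⟩ := h.pareto_nonempty M' hM'
  exact le_antisymm ((iInf₂_le p hp).trans_eq (h.relaxedInf_eq hM' hp _))
    (le_iInf₂ fun q hq => (h.relaxedInf_eq hM' hq _).ge)

lemma fixedInf_le_add (h : LocalModel C Mmin Mmax D P M A ξ B ε) {M' M'' : Inst L K}
    (hM' : ∀ k, ‖M' k - M k‖ ≤ ξ) (hM'' : ∀ k, ‖M'' k - M k‖ ≤ ξ) {u : Fin K → ℝ}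
    (hu : u ∈ stdSimplex ℝ (Fin K)) :
    fixedInf C P A (fun k => ENNReal.ofReal (u k)) M'
      ≤ fixedInf C P A (fun k => ENNReal.ofReal (u k)) M'' + ENNReal.ofReal ε := by
  refine tsub_le_iff_right.1 (le_iInf₂ fun N hN => le_iInf₂ fun z hz => tsub_le_iff_right.2 ?_)
  refine (fixedInf_le hN hz).trans ?_
  calc ∑ k, ENNReal.ofReal (u k) * projKL P z (M' k) (N k)
      ≤ ∑ k, ENNReal.ofReal (u k) * (projKL P z (M'' k) (N k) + ENNReal.ofReal ε) := by
        gcongr with k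
        exact h.projKL_le_add M' M'' hM' hM'' N hN k z
    _ = _ := by
        simp only [mul_add, Finset.sum_add_distrib, ← Finset.sum_mul]
        rw [← ENNReal.ofReal_sum_of_nonneg fun k _ => hu.1 k, hu.2, ENNReal.ofReal_one, one_mul]

/-- An allocation that is optimal for an instance near `M` is almost optimal for all others. -/
lemma le_sum_of_isMaxOn (h : LocalModel C Mmin Mmax D P M A ξ B ε) (hξ : 0 ≤ ξ) (hε : 0 ≤ ε)
    {V : ℝ} {u₀ u : Fin K → ℝ} (hu₀ : u₀ ∈ stdSimplex ℝ (Fin K))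
    (hV : ENNReal.ofReal V ≤ relaxedValue C Mmin Mmax P u₀ M) {M' M'' : Inst L K}
    (hM' : ∀ k, ‖M' k - M k‖ ≤ ξ) (hM'' : ∀ k, ‖M'' k - M k‖ ≤ ξ)
    (hu : u ∈ stdSimplex ℝ (Fin K))
    (hmax : IsMaxOn (fun u => relaxedValue C Mmin Mmax P u M') (stdSimplex ℝ (Fin K)) u)
    {N : Inst L K} (hN : N ∈ A) {z : Vec L} (hz : z ∈ C \ {0}) :
    V - 2 * ε ≤ ∑ k, u k * (projKL P z (M'' k) (N k)).toReal := by
  have hM : ∀ k, ‖M k - M k‖ ≤ ξ := fun k => by simpa using hξ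
  have hfin : ∀ k, projKL P z (M'' k) (N k) ≠ ⊤ := fun k =>
    ((h.projKL_le M'' hM'' N hN k z).trans_lt ENNReal.ofReal_lt_top).ne
  -- One `ε` is paid to pass from `M` to `M'`, where `u` is optimal, and another from `M'` to `M''`.
  have h1 : ENNReal.ofReal V ≤ fixedInf C P A (fun k => ENNReal.ofReal (u k)) M''
      + ENNReal.ofReal ε + ENNReal.ofReal ε := by
    rw [h.relaxedValue_eq hM] at hV
    refine hV.trans ((h.fixedInf_le_add hM hM' hu₀).trans (add_le_add_left ?_ _))
    have := hmax hu₀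
    simp only [mem_ofPred_eq, h.relaxedValue_eq hM'] at this
    exact this.trans (h.fixedInf_le_add hM' hM'' hu)
  have h2 : fixedInf C P A (fun k => ENNReal.ofReal (u k)) M''
      ≤ ENNReal.ofReal (∑ k, u k * (projKL P z (M'' k) (N k)).toReal) := by
    refine (fixedInf_le hN hz).trans_eq ?_
    rw [ENNReal.ofReal_sum_of_nonneg fun k _ => mul_nonneg (hu.1 k) ENNReal.toReal_nonneg]
    refine Finset.sum_congr rfl fun k _ => ?_
    rw [ENNReal.ofReal_mul (hu.1 k), ENNReal.ofReal_toReal (hfin k)]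
  have h3 : (0 : ℝ) ≤ ∑ k, u k * (projKL P z (M'' k) (N k)).toReal :=
    Finset.sum_nonneg fun k _ => mul_nonneg (hu.1 k) ENNReal.toReal_nonneg
  have h4 := h1.trans (add_le_add_left (add_le_add_left h2 _) _)
  rw [← ENNReal.ofReal_add h3 hε, ← ENNReal.ofReal_add (by linarith) hε,
    ENNReal.ofReal_le_ofReal_iff (by linarith)] at h4
  linarith

end LocalModel

/-- The pulls follow the allocations, so they inherit a lower bound on the linear objective. -/
lemma le_sum_pulls_mul {n : Fin K → ℝ} {w v : ℕ → Fin K → ℝ} {κ : Fin K → ℝ} {V ρ : ℝ} {s₀ T : ℕ}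
    (hκ : ∀ k, 0 ≤ κ k) (hκB : ∀ k, κ k ≤ B) (hV : ∀ s, s₀ ≤ s → s < T → V ≤ ∑ k, w s k * κ k)
    (hv : ∀ s, v s ∈ stdSimplex ℝ (Fin K)) (hvw : ∀ s, s₀ ≤ s → ‖v s - w s‖ ≤ ρ)
    (hB : 0 ≤ B) (hρ : 0 ≤ V - K * (ρ * B))
    (hn : ∀ k, ∑ s ∈ Finset.range T, v s k - K ≤ n k) :
    ((T : ℝ) - s₀) * (V - K * (ρ * B)) - K * (K * B) ≤ ∑ k, n k * κ k := by
  have h1 : ∀ s, s₀ ≤ s → s < T → V - K * (ρ * B) ≤ ∑ k, v s k * κ k := by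
    intro s hs hsT
    have h2 : ∑ k, (w s k - v s k) * κ k ≤ ∑ _k : Fin K, ρ * B := by
      refine Finset.sum_le_sum fun k _ => ?_
      have h3 : w s k - v s k ≤ ρ := by
        have := (norm_le_pi_norm (v s - w s) k).trans (hvw s hs)
        rw [Real.norm_eq_abs, Pi.sub_apply] at this
        linarith [(abs_le.1 this).1]
      have hρ0 : 0 ≤ ρ := (norm_nonneg _).trans (hvw s hs)
      calc (w s k - v s k) * κ k ≤ ρ * κ k := by gcongr; exact hκ k
        _ ≤ ρ * B := by gcongr; exact hκB k
    simp only [sub_mul, Finset.sum_sub_distrib, Finset.sum_const, Finset.card_univ,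
      Fintype.card_fin, nsmul_eq_mul] at h2
    linarith [hV s hs hsT]
  -- The rounds before `s₀` contribute nonnegative terms and are dropped.
  have h4 : ((T : ℝ) - s₀) * (V - K * (ρ * B)) ≤ ∑ s ∈ Finset.range T, ∑ k, v s k * κ k := by
    calc ((T : ℝ) - s₀) * (V - K * (ρ * B))
        ≤ ((T - s₀ : ℕ) : ℝ) * (V - K * (ρ * B)) := by
          gcongr
          have : T ≤ T - s₀ + s₀ := by omega
          have : (T : ℝ) ≤ ((T - s₀ : ℕ) : ℝ) + s₀ := by exact_mod_cast this
          linarith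
      _ = ∑ s ∈ Finset.Ico s₀ T, (V - K * (ρ * B)) := by
          rw [Finset.sum_const, Nat.card_Ico, nsmul_eq_mul]
      _ ≤ ∑ s ∈ Finset.Ico s₀ T, ∑ k, v s k * κ k :=
          Finset.sum_le_sum fun s hs => h1 s (Finset.mem_Ico.1 hs).1 (Finset.mem_Ico.1 hs).2
      _ ≤ _ := by
          refine Finset.sum_le_sum_of_subset_of_nonneg (fun s hs => ?_)
            fun s _ _ => Finset.sum_nonneg fun k _ => mul_nonneg ((hv s).1 k) (hκ k)
          exact Finset.mem_range.2 (Finset.mem_Ico.1 hs).2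
  have h5 : ∑ k, (∑ s ∈ Finset.range T, v s k - K) * κ k ≤ ∑ k, n k * κ k := by
    gcongr with k
    · exact hκ k
    · exact hn k
  have h6 : ∑ k, (K : ℝ) * κ k ≤ K * (K * B) := by
    rw [← Finset.mul_sum]
    gcongr
    refine (Finset.sum_le_sum fun k _ => hκB k).trans_eq ?_
    simp
  simp only [sub_mul, Finset.sum_sub_distrib, Finset.sum_mul] at h5
  rw [Finset.sum_comm] at h5
  linarith

end Local


/-! ### Pathwise and mean bounds on the stopping time -/

section Stopping

variable {L K : ℕ} {C : Set (Vec L)} {Mmin Mmax : ℝ} {D : Set (Vec L)}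
  {P : Vec L → Measure (Vec L)} {M : Inst L K}

lemma norm_empMean_sub_le {Ω : Type*} {arm : ℕ → Ω → Fin K} {R : ℕ → Ω → Vec L} {ξ : ℝ} {t : ℕ}
    {ω : Ω} (h0 : ∀ k, 0 < pulls arm t ω k) (h : ω ∉ deviates M ξ arm R t) (k : Fin K) :
    ‖empMean arm R t ω k - M k‖ ≤ ξ := by
  by_contra! hcon
  exact h ⟨k, h0 k, hcon⟩

/-- For fixed `N` and `z`, the divergences from the empirical means at time `T` are fixed
coefficients. Each allocation since `s₀`, though computed from an earlier estimate, is almost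
optimal against them, and `le_sum_pulls_mul` adds up these bounds. -/
lemma IsRun.le_stopStat {Ω : Type*} [mΩ : MeasurableSpace Ω] {Pr : Measure Ω} {ℱ : Filtration ℕ mΩ}
    {arm : ℕ → Ω → Fin K} {R : ℕ → Ω → Vec L} {w v : ℕ → Ω → Fin K → ℝ}
    (hrun : IsRun C Mmin Mmax D P M Pr ℱ arm R w v) (hK : 0 < K) {A : Set (Inst L K)} {ξ B ε ρ V : ℝ}
    (h : LocalModel C Mmin Mmax D P M A ξ B ε) (hξ : 0 ≤ ξ) (hε : 0 ≤ ε)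
    {u₀ : Fin K → ℝ} (hu₀ : u₀ ∈ stdSimplex ℝ (Fin K))
    (hV : ENNReal.ofReal V ≤ relaxedValue C Mmin Mmax P u₀ M)
    {s₀ T : ℕ} {ω : Ω} (hs₀ : s₀ ≤ T) (hpull : ∀ s, s₀ ≤ s → ∀ k, 0 < pulls arm s ω k)
    (hdev : ∀ s, s₀ ≤ s → ω ∉ deviates M ξ arm R s) (hρ : ∀ s, s₀ ≤ s → K * explore K s ≤ ρ)
    (hpos : 0 ≤ V - 2 * ε - K * (ρ * B)) :
    ENNReal.ofReal (((T : ℝ) - s₀) * (V - 2 * ε - K * (ρ * B)) - K * (K * B))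
      ≤ stopStat C Mmin Mmax P arm R T ω := by
  have hnear : ∀ s, s₀ ≤ s → ∀ k, ‖empMean arm R s ω k - M k‖ ≤ ξ := fun s hs =>
    norm_empMean_sub_le (hpull s hs) (hdev s hs)
  obtain ⟨p, hp⟩ := h.pareto_nonempty _ (hnear T hs₀)
  refine le_trans ?_ (le_iSup₂ (f := fun p _ => relaxedInf C Mmin Mmax P
    (fun k => (pulls arm T ω k : ℝ≥0∞)) (empMean arm R T ω) p) p hp)
  rw [h.relaxedInf_eq (hnear T hs₀) hp]
  refine le_iInf₂ fun N hN => le_iInf₂ fun z hz => ?_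
  have hB := fun k => h.projKL_le _ (hnear T hs₀) N hN k z
  have hfin : ∀ k, projKL P z (empMean arm R T ω k) (N k) ≠ ⊤ := fun k =>
    ((hB k).trans_lt ENNReal.ofReal_lt_top).ne
  have hsum : ∑ k, (pulls arm T ω k : ℝ≥0∞) * projKL P z (empMean arm R T ω k) (N k)
      = ENNReal.ofReal
        (∑ k, (pulls arm T ω k : ℝ) * (projKL P z (empMean arm R T ω k) (N k)).toReal) := by
    rw [ENNReal.ofReal_sum_of_nonneg fun k _ => mul_nonneg (Nat.cast_nonneg _)
      ENNReal.toReal_nonneg]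
    refine Finset.sum_congr rfl fun k _ => ?_
    rw [ENNReal.ofReal_mul (Nat.cast_nonneg _), ENNReal.ofReal_toReal (hfin k),
      ENNReal.ofReal_natCast]
  rw [hsum]
  refine ENNReal.ofReal_le_ofReal (le_sum_pulls_mul (w := fun s => w s ω) (v := fun s => v s ω)
    (fun k => ENNReal.toReal_nonneg) (fun k => ENNReal.toReal_le_of_le_ofReal h.bound_nonneg (hB k))
    (fun s hs _ => ?_) (fun s => (hrun.proj_mem s ω).1) (fun s hs => ?_) h.bound_nonneg hpos
    (sum_alloc_sub_le_pulls (fun t => (hrun.proj_mem t ω).1) (fun t => hrun.track t ω) T))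
  · refine h.le_sum_of_isMaxOn hξ hε hu₀ hV (hnear s hs) (hnear T hs₀) (hrun.alloc_mem s ω)
      (hrun.alloc_opt s ω fun k => ⟨hpull s hs k, ?_⟩) hN hz
    exact h.mem_domain _ (hnear s hs) k
  · exact (norm_proj_sub_le (explore_pos K hK s).le
      ((mul_explore_le_half K hK s).trans (by norm_num)) (hrun.alloc_mem s ω)
      (hrun.proj_min s ω)).trans (hρ s hs)

lemma tendsto_mul_explore_sub (hK : 0 < K) :
    Tendsto (fun t : ℕ => t * explore K t - K) atTop atTop := by
  refine tendsto_atTop_add_const_right _ (-(K : ℝ)) ?_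
  refine tendsto_atTop_mono (sqrt_le_mul_explore K hK) ?_
  exact (Real.tendsto_sqrt_atTop.comp tendsto_natCast_atTop_atTop).atTop_div_const (by positivity)

/-- The algorithm stops as soon as `T ≥ log (1 / δ) / V` and no empirical mean deviates after a
small fraction of the rounds. -/
lemma exists_stopTime_le (hK : 0 < K) {A : Set (Inst L K)} {ξ B V V₂ : ℝ} (hξ : 0 ≤ ξ)
    (hV : 0 < V) (hVV : V < V₂)
    (h : LocalModel C Mmin Mmax D P M A ξ B ((V₂ - V) / 8))
    {u₀ : Fin K → ℝ} (hu₀ : u₀ ∈ stdSimplex ℝ (Fin K))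
    (hV₂ : ENNReal.ofReal V₂ ≤ relaxedValue C Mmin Mmax P u₀ M) :
    ∃ r : ℝ, 0 < r ∧ ∃ T₀ : ℕ, ∀ᶠ ℓ : ℝ in atTop, ∀ {Ω : Type*} [mΩ : MeasurableSpace Ω] (Pr : Measure Ω)
      (ℱ : Filtration ℕ mΩ) (arm : ℕ → Ω → Fin K) (R : ℕ → Ω → Vec L) (w v : ℕ → Ω → Fin K → ℝ),
      IsRun C Mmin Mmax D P M Pr ℱ arm R w v → ∀ (ω : Ω) (δ : ℝ), Real.log (1 / δ) = ℓ →
      ∀ T : ℕ, ℓ / V ≤ T → T₀ ≤ T → (∀ s : ℕ, r * T ≤ s → ω ∉ deviates M ξ arm R s) →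
      stopTime C Mmin Mmax D P arm R δ ω ≤ T := by
  -- The gap is `8 * e`. Per round, `2 * e` pays for changes of instance and `e` each for the
  -- projection, the first `r * T` rounds, the additive constants, the `log T` of the threshold and
  -- its factor `1 + e / V`.
  set e := (V₂ - V) / 8 with he
  have he0 : 0 < e := by rw [he]; linarith
  have hV₂e : V₂ = V + 8 * e := by rw [he]; ring
  have hK' : (0 : ℝ) < K := by exact_mod_cast hK
  have hB0 := h.bound_nonneg
  set r := e / V₂ with hr
  have hr0 : 0 < r := div_pos he0 (by linarith)
  have hrV : r * V₂ = e := by rw [hr]; exact div_mul_cancel₀ _ (by linarith)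
  have hr1 : r ≤ 1 := by rw [hr, div_le_one (by linarith)]; linarith
  set ρ := e / (K * (B + 1)) with hρ
  have hρ0 : 0 < ρ := by positivity
  have hρB : K * (ρ * B) ≤ e := by
    rw [hρ]
    have : K * (e / (K * (B + 1)) * B) = e * (B / (B + 1)) := by field_simp
    rw [this]
    have : B / (B + 1) ≤ 1 := by rw [div_le_one (by positivity)]; linarith
    nlinarith
  have hρB0 : 0 ≤ K * (ρ * B) := by positivity
  have hs : ∀ᶠ s : ℕ in atTop, K * explore K s ≤ ρ ∧ 0 < s * explore K s - K := by
    have h1 := (tendsto_explore K).const_mul (K : ℝ)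
    rw [mul_zero] at h1
    exact (h1.eventually_le_const hρ0).and ((tendsto_mul_explore_sub hK).eventually_gt_atTop 0)
  obtain ⟨s₁, hs₁⟩ := eventually_atTop.1 hs
  have hT : ∀ᶠ T : ℕ in atTop, (s₁ : ℝ) ≤ r * T ∧ V₂ + K * (K * B) ≤ e * T ∧
      3 * K * Real.log T ≤ e * T ∧ 0 < T := by
    have hc : Tendsto (fun T : ℕ => (T : ℝ)) atTop atTop := tendsto_natCast_atTop_atTop
    have hlog := (tendsto_log_div_atTop.comp hc).const_mul (3 * (K : ℝ))
    rw [mul_zero] at hlog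
    filter_upwards [(hc.const_mul_atTop hr0).eventually_ge_atTop (s₁ : ℝ),
      (hc.const_mul_atTop he0).eventually_ge_atTop (V₂ + K * (K * B)),
      hlog.eventually_le_const he0, eventually_gt_atTop 0] with T h1 h2 h3 h4
    refine ⟨h1, h2, ?_, h4⟩
    have h4' : (0 : ℝ) < T := by exact_mod_cast h4
    simp only [Function.comp, ← mul_div_assoc] at h3
    rwa [div_le_iff₀ h4'] at h3
  obtain ⟨T₀, hT₀⟩ := eventually_atTop.1 hT
  refine ⟨r, hr0, T₀, ?_⟩
  filter_upwards [eventually_mul_calT_le hK (div_pos he0 hV)] with ℓ hℓ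
  intro Ω _ Pr ℱ arm R w v hrun ω δ hδ T hTℓ hTT hdev
  obtain ⟨hT1, hT2, hT3, hT4⟩ := hT₀ T hTT
  have hT0 : (0 : ℝ) < T := by exact_mod_cast hT4
  set s₀ := ⌈r * T⌉₊ with hs₀
  have hrT : r * T ≤ s₀ := Nat.le_ceil _
  have hs₀T : s₀ ≤ T := Nat.ceil_le.2 (by nlinarith)
  have hs₁₀ : s₁ ≤ s₀ := by exact_mod_cast hT1.trans hrT
  have hs₀' : (s₀ : ℝ) < r * T + 1 := Nat.ceil_lt_add_one (by positivity)
  have hge : ∀ s, s₀ ≤ s → r * T ≤ s := fun s hs => hrT.trans (by exact_mod_cast hs)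
  have hpull : ∀ s, s₀ ≤ s → ∀ k, 0 < pulls arm s ω k := by
    intro s hs k
    have := (hs₁ s (hs₁₀.trans hs)).2.trans_le (mul_explore_sub_le_pulls hK
      (fun t => hrun.proj_mem t ω) (fun t => hrun.track t ω) s k)
    exact_mod_cast this
  have hstat := hrun.le_stopStat hK h hξ he0.le hu₀ hV₂ hs₀T hpull (fun s hs => hdev s (hge s hs))
    (fun s hs => (hs₁ s (hs₁₀.trans hs)).1) (by linarith)
  refine iInf₂_le T ⟨fun k => ⟨hpull T hs₀T k, h.mem_domain _ (norm_empMean_sub_le (hpull T hs₀T)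
    (hdev T (hge T hs₀T))) k⟩, (ENNReal.ofReal_le_ofReal ?_).trans hstat⟩
  refine (threshold_le (hpull T hs₀T) (fun k => pulls_le arm T ω k) δ).trans ?_
  rw [hδ]
  have h1 : (1 + e / V) * ℓ ≤ (V + e) * T := by
    have : (1 + e / V) * ℓ = (V + e) * (ℓ / V) := by field_simp
    rw [this]
    gcongr
  set V' := V₂ - 2 * e - K * (ρ * B) with hV'
  have h2 : ((1 - r) * T - 1) * V' ≤ ((T : ℝ) - s₀) * V' :=
    mul_le_mul_of_nonneg_right (by linarith) (by linarith)
  have h3 : T * (V₂ - 4 * e) - V₂ ≤ ((1 - r) * T - 1) * V' := by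
    have h4 : (1 - r) * T * (V₂ - 3 * e) ≤ (1 - r) * T * V' := by
      have : 0 ≤ 1 - r := by linarith
      gcongr
      linarith
    have h5 : r * T * (V₂ - 3 * e) ≤ e * T := by
      rw [← hrV]
      have : 0 ≤ r * T := by positivity
      nlinarith
    nlinarith
  nlinarith

/-- The expected stopping time is at most `log (1 / δ) / V`, up to an additive constant. -/
lemma exists_lintegral_stopTime_le (hK : 0 < K) (hC : IsPreferenceCone C)
    (hP : IsMeanExpFamily D P) (hD : ∀ x : Vec L, (∀ l, x l ∈ Icc Mmin Mmax) → x ∈ D)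
    (hM : M ∈ instSet L K Mmin Mmax) {σ : ℝ≥0} (hσ : ∀ k, IsSubGaussianVec (P (M k)) (M k) σ)
    {V V₂ : ℝ} (hV : 0 < V) (hVV : V < V₂)
    {u₀ : Fin K → ℝ} (hu₀ : u₀ ∈ stdSimplex ℝ (Fin K))
    (hV₂ : ENNReal.ofReal V₂ ≤ relaxedValue C Mmin Mmax P u₀ M) :
    ∃ c : ℝ≥0∞, c ≠ ⊤ ∧ ∀ᶠ ℓ : ℝ in atTop, ∀ {Ω : Type*} [mΩ : MeasurableSpace Ω]
      (Pr : Measure Ω) [IsProbabilityMeasure Pr] (ℱ : Filtration ℕ mΩ) (arm : ℕ → Ω → Fin K)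
      (R : ℕ → Ω → Vec L) (w v : ℕ → Ω → Fin K → ℝ),
      IsRun C Mmin Mmax D P M Pr ℱ arm R w v → ∀ δ : ℝ, Real.log (1 / δ) = ℓ →
      ∫⁻ ω, stopTime C Mmin Mmax D P arm R δ ω ∂Pr ≤ ENNReal.ofReal (ℓ / V) + c := by
  have hprob : ∀ k, IsProbabilityMeasure (P (M k)) := by
    obtain ⟨-, d, h, T, η, ψ, -, -, -, -, hfam⟩ := hP
    exact fun k => (hfam (M k) (hD _ (hM k))).2.2.1
  have hV₂0 : 0 < ENNReal.ofReal V₂ := ENNReal.ofReal_pos.2 (by linarith)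
  obtain ⟨A, ξ, B, hξ, hloc⟩ := exists_localModel hK hC hP hD hM (hV₂0.trans_le hV₂).ne'
    (by linarith : 0 < (V₂ - V) / 8)
  obtain ⟨r, hr, T₀, hbnd⟩ := exists_stopTime_le hK hξ.le hV hVV hloc hu₀ hV₂
  obtain ⟨c, hc⟩ := exists_lintegral_deviates_le (L := L) hK σ hξ
  refine ⟨T₀ + (ENNReal.ofReal r⁻¹ * c + 1), by finiteness, ?_⟩
  filter_upwards [hbnd, eventually_ge_atTop 0] with ℓ hℓ hℓ0
  intro Ω _ Pr _ ℱ arm R w v hrun δ hδ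
  set Z : Ω → ℝ≥0∞ := fun ω =>
    ∑' t : ℕ, ((t : ℝ≥0∞) + 1) * (deviates M ξ arm R t).indicator 1 ω with hZ
  have hbound : ∀ ω, stopTime C Mmin Mmax D P arm R δ ω
      ≤ ENNReal.ofReal (ℓ / V) + T₀ + 1 + ENNReal.ofReal r⁻¹ * Z ω := by
    intro ω
    rcases eq_or_ne (Z ω) ⊤ with hZt | hZt
    · rw [hZt, ENNReal.mul_top (by simpa using hr)]
      simp
    -- With `T = ⌈x⌉₊`, a deviation at some `s ≥ r * T` would have `s ≥ Z ω`, yet it alone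
    -- contributes `s + 1` to `Z ω`.
    set x : ℝ := ℓ / V + T₀ + r⁻¹ * (Z ω).toReal with hx
    have hZ0 : (0 : ℝ) ≤ r⁻¹ * (Z ω).toReal := by positivity
    have hℓV : 0 ≤ ℓ / V := by positivity
    have hle : x ≤ ⌈x⌉₊ := Nat.le_ceil x
    refine (hℓ Pr ℱ arm R w v hrun ω δ hδ ⌈x⌉₊ ?_ ?_ ?_).trans ?_
    · have : (0 : ℝ) ≤ T₀ := Nat.cast_nonneg _
      linarith
    · have : (T₀ : ℝ) ≤ ⌈x⌉₊ := by linarith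
      exact_mod_cast this
    · intro s hs hmem
      have h1 : (Z ω).toReal ≤ s := by
        have : r * (r⁻¹ * (Z ω).toReal) ≤ r * ⌈x⌉₊ := by
          gcongr
          have : (0 : ℝ) ≤ T₀ := Nat.cast_nonneg _
          linarith
        rw [mul_inv_cancel_left₀ hr.ne'] at this
        exact this.trans hs
      have h2 : (s : ℝ≥0∞) + 1 ≤ Z ω := by
        have := ENNReal.le_tsum (f := fun t : ℕ =>
          ((t : ℝ≥0∞) + 1) * (deviates M ξ arm R t).indicator 1 ω) s
        simpa [indicator_of_mem hmem] using this
      have h3 := ENNReal.toReal_mono hZt h2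
      rw [ENNReal.toReal_add (by simp) (by simp)] at h3
      simp only [ENNReal.toReal_natCast, ENNReal.toReal_one] at h3
      linarith
    · have h4 : ((⌈x⌉₊ : ℝ≥0∞)) ≤ ENNReal.ofReal (x + 1) := by
        rw [← ENNReal.ofReal_natCast]
        exact ENNReal.ofReal_le_ofReal (Nat.ceil_lt_add_one (by positivity)).le
      refine h4.trans_eq ?_
      rw [hx, ENNReal.ofReal_add (by positivity) one_pos.le, ENNReal.ofReal_add (by positivity) hZ0,
        ENNReal.ofReal_add hℓV (by positivity), ENNReal.ofReal_mul (by positivity),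
        ENNReal.ofReal_toReal hZt, ENNReal.ofReal_natCast, ENNReal.ofReal_one]
      ring
  calc ∫⁻ ω, stopTime C Mmin Mmax D P arm R δ ω ∂Pr
      ≤ ∫⁻ ω, (ENNReal.ofReal (ℓ / V) + T₀ + 1 + ENNReal.ofReal r⁻¹ * Z ω) ∂Pr :=
        lintegral_mono hbound
    _ = ENNReal.ofReal (ℓ / V) + T₀ + 1 + ENNReal.ofReal r⁻¹ * ∫⁻ ω, Z ω ∂Pr := by
        rw [lintegral_add_left measurable_const, lintegral_const_mul' _ _ ENNReal.ofReal_ne_top]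
        simp
    _ ≤ ENNReal.ofReal (ℓ / V) + T₀ + 1 + ENNReal.ofReal r⁻¹ * c := by
        gcongr
        exact hc P M Pr ℱ arm R hprob hσ hrun.arm_meas hrun.reward_meas hrun.reward_law
          fun t ω k => mul_explore_sub_le_pulls hK (fun t => hrun.proj_mem t ω)
            (fun t => hrun.track t ω) t k
    _ = _ := by ring

end Stopping

end PreTS

/-! ### Passage to the limit -/

theorem theorem7 {L K : ℕ} (hK : 0 < K)
    (C : Set (PreTS.Vec L)) (hC : PreTS.IsPreferenceCone C)
    (Mmin Mmax : ℝ)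
    (D : Set (PreTS.Vec L)) (P : PreTS.Vec L → Measure (PreTS.Vec L))
    (hP : PreTS.IsMeanExpFamily D P)
    (hD : ∀ x : PreTS.Vec L, (∀ l, x l ∈ Set.Icc Mmin Mmax) → x ∈ D)
    (M : PreTS.Inst L K) (hM : M ∈ PreTS.instSet L K Mmin Mmax)
    (σ : ℝ≥0) (hσ : ∀ k, PreTS.IsSubGaussianVec (P (M k)) (M k) σ)
    {Ω : ℝ → Type*} [mΩ : ∀ δ, MeasurableSpace (Ω δ)]
    (Pr : ∀ δ, Measure (Ω δ)) [∀ δ, IsProbabilityMeasure (Pr δ)]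
    (ℱ : ∀ δ, Filtration ℕ (mΩ δ))
    (arm : ∀ δ, ℕ → Ω δ → Fin K) (R : ∀ δ, ℕ → Ω δ → PreTS.Vec L)
    (w v : ∀ δ, ℕ → Ω δ → Fin K → ℝ)
    (hrun : ∀ δ ∈ Set.Ioo (0 : ℝ) 1,
      PreTS.IsRun C Mmin Mmax D P M (Pr δ) (ℱ δ) (arm δ) (R δ) (w δ) (v δ)) :
    Filter.limsup
      (fun δ : ℝ => (∫⁻ ω, PreTS.stopTime C Mmin Mmax D P (arm δ) (R δ) δ ω ∂(Pr δ)) /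
        ENNReal.ofReal (Real.log (1 / δ)))
      (𝓝[>] (0 : ℝ))
      ≤ PreTS.relaxedTime C Mmin Mmax P M := by
  rw [PreTS.relaxedTime]
  set S := ⨆ u ∈ stdSimplex ℝ (Fin K), PreTS.relaxedValue C Mmin Mmax P u M with hS
  set f : ℝ → ℝ≥0∞ := fun δ =>
    (∫⁻ ω, PreTS.stopTime C Mmin Mmax D P (arm δ) (R δ) δ ω ∂(Pr δ)) /
      ENNReal.ofReal (Real.log (1 / δ)) with hf
  have hlog : Tendsto (fun δ : ℝ => Real.log (1 / δ)) (𝓝[>] 0) atTop := by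
    simp only [one_div]
    exact Real.tendsto_log_atTop.comp tendsto_inv_nhdsGT_zero
  have key : ∀ V : ℝ≥0, 0 < V → (V : ℝ≥0∞) < S → limsup f (𝓝[>] 0) ≤ (V : ℝ≥0∞)⁻¹ := by
    intro V hV hVS
    obtain ⟨V₂, hVV, hVS₂⟩ := ENNReal.lt_iff_exists_nnreal_btwn.1 hVS
    obtain ⟨u₀, hu₀, hV₂⟩ := lt_biSup_iff.1 hVS₂
    obtain ⟨c, hc, hbound⟩ := PreTS.exists_lintegral_stopTime_le hK hC hP hD hM hσ
      (V := V) (V₂ := V₂) (by exact_mod_cast hV) (by exact_mod_cast hVV) hu₀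
      (by simpa using hV₂.le)
    -- The additive constant vanishes after division by `log (1 / δ)`.
    have hlim : Tendsto (fun δ : ℝ => (V : ℝ≥0∞)⁻¹ + c / ENNReal.ofReal (Real.log (1 / δ)))
        (𝓝[>] 0) (𝓝 ((V : ℝ≥0∞)⁻¹ + c / ⊤)) :=
      tendsto_const_nhds.add (ENNReal.Tendsto.const_div
        (ENNReal.tendsto_ofReal_atTop.comp hlog) (Or.inr hc))
    rw [ENNReal.div_top, add_zero] at hlim
    rw [← hlim.limsup_eq]
    refine limsup_le_limsup ?_
    filter_upwards [hlog.eventually hbound, hlog.eventually_gt_atTop 0,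
      Ioo_mem_nhdsGT (one_pos (α := ℝ))] with δ h1 h2 h3
    have h4 := h1 (Pr δ) (ℱ δ) (arm δ) (R δ) (w δ) (v δ) (hrun δ h3) δ rfl
    have h5 : ENNReal.ofReal (Real.log (1 / δ)) ≠ 0 := by simpa using h2
    rw [hf]
    refine (ENNReal.div_le_div_right h4 _).trans_eq ?_
    rw [ENNReal.add_div, ENNReal.ofReal_div_of_pos (by exact_mod_cast hV), ENNReal.ofReal_coe_nnreal,
      div_eq_mul_inv, div_eq_mul_inv, mul_right_comm, ENNReal.mul_inv_cancel h5 ENNReal.ofReal_ne_top,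
      one_mul]
  -- A limsup above `S⁻¹` leaves room for a `V` strictly between its inverse and `S`, against `key`;
  -- this covers `S = 0` and `S = ∞` as well.
  by_contra! hcon
  obtain ⟨V, hV₁, hV₂⟩ := ENNReal.lt_iff_exists_nnreal_btwn.1 (ENNReal.inv_lt_iff_inv_lt.1 hcon)
  have hV0 : 0 < V := ENNReal.coe_pos.1 (bot_le.trans_lt hV₁)
  exact absurd (ENNReal.le_inv_iff_le_inv.1 (key V hV0 hV₂)) (not_le.2 hV₁)
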